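/- **Setting.** Fix an integer $\kappa\ge 0$. Boxes are labelled from left to right by $\mathbb{N}=\{0,1,2,\dots\}$ (the label of the first box is immaterial). A $\kappa$-color box-ball configuration is a map $X:\mathbb{N}\to\{0,1,\dots,\kappa\}$ with finite support; box $x$ is empty if $X(x)=0$ and holds a ball of color $i$ if $X(x)=i\ge 1$. For $1\le a\le\kappa$ let $K_a(X)$ be obtained from $X$ by moving the balls of color $a$, successively from left to right and each once, to the leftmost empty box to their right. The trajectory started at $X_0$ is $X_{t+1}=K_1\circ K_2\circ\cdots\circ K_\kappa(X_t)$, $t\ge 0$. A *block* of $X$ is a maximal set of consecutive occupied boxes along which the colors are non-increasing from left to right. The trajectory is *decomposed into solitons from time $T$ on* if, for all $t\ge T$, the color words of the blocks of $X_t$, listed from left to right, form the same list, with lengths non-decreasing from left to right; these words are the solitons. $\Lambda(X_0)$ denotes the Young diagram whose $j$-th column length $\lambda_j$ is the length of the $j$-th longest soliton ($0$ if there are fewer than $j$ solitons); $\rho_j$ denotes its $j$-th row length. For $A\subseteq\mathbb{N}$ with elements $a_1<a_2<\cdots$ put $$\mathrm{NA}(A,X)=\mathbf 1(X(a_1)>0)+\sum_{i\ge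 2}\mathbf 1\big(X(a_{i-1})<X(a_i)\big),\qquad \mathrm{NA}(\varnothing,X)=0,$$ that is, the number of ascents of $X$ along $A$ when the sequence is preceded by a $0$. For finite $A\subseteq\mathbb{N}$ put $$\mathrm{L}(A,X)=\Big[|A|-\#\{i:\min A\le i\le\max A,\ X(i)=0\}\Big]\,\mathbf 1(X\text{ is non-increasing on }A),\qquad \mathrm{L}(\varnothing,X)=0.$$ Write $A\prec B$ if every element of $A$ is smaller than every element of $B$. **Lemma 2.1.** Let $(X_t)_{t\ge 0}$ be a $\kappa$-color box-ball trajectory such that $X_0$ has finite support. Then the trajectory is decomposed into solitons from some time on, the diagram $\Lambda(X_0)$ is thereby uniquely determined, and for every $t\ge 0$ $$\rho_1+\cdots+\rho_k=\max_{A_1\sqcup\cdots\sqcup A_k=\mathbb{N}}\ \sum_{i=1}^k\mathrm{NA}(A_i,X_t)\qquad(k\ge 1),$$ $$\lambda_1+\cdots+\lambda_k=\max_{A_1\prec\cdots\prec A_k}\ \sum_{i=1}^k\mathrm{L}(A_i,X_t)\qquad(k\ge 0).$$ The first maximum is over all partitions of $\mathbb{N}$ into $k$ pairwise disjoint, possibly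 empty, sets; the second is over all $k$-tuples of finite, possibly empty, sets $A_1,\dots,A_k\subseteq\mathbb{N}$ with $A_i\prec A_j$ for all $i<j$. Both maxima are attained. -/

import Mathlib

namespace BoxBall

/-- A `κ`-color box-ball configuration with finite support. The boxes form a half-infinite row,
labelled from left to right by `0, 1, 2, …`; `X x = 0` means that box `x` is empty, and
`X x = i` with `1 ≤ i ≤ κ` means that it holds a ball of color `i`. -/
abbrev Config (κ : ℕ) : Type := ℕ →₀ Fin (κ + 1)

/-- The leftmost empty box strictly to the right of box `x`. -/
noncomputable def nextEmpty {κ : ℕ} (X : Config κ) (x : ℕ) : ℕ :=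
  sInf {y | x < y ∧ X y = 0}

/-- The leftmost empty box to the right always exists, so `nextEmpty` is never a junk value. -/
theorem nextEmpty_spec {κ : ℕ} (X : Config κ) (x : ℕ) :
    IsLeast {y | x < y ∧ X y = 0} (nextEmpty X x) := by
  have hne : {y | x < y ∧ X y = 0}.Nonempty := by
    obtain ⟨y, hy⟩ := Infinite.exists_notMem_finset (X.support ∪ Finset.range (x + 1))
    simp only [Finset.mem_union, Finsupp.mem_support_iff, Finset.mem_range, not_or, not_not] at hy
    exact ⟨y, by omega, hy.1⟩
  exact ⟨Nat.sInf_mem hne, fun _ hy => Nat.sInf_le hy⟩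

/-- Move the content of box `x` to the leftmost empty box to its right. -/
noncomputable def moveBall {κ : ℕ} (X : Config κ) (x : ℕ) : Config κ :=
  (X.update x 0).update (nextEmpty X x) (X x)

/-- The boxes holding a ball of color `a`, listed from left to right. -/
noncomputable def sites {κ : ℕ} (X : Config κ) (a : Fin (κ + 1)) : List ℕ :=
  (X.support.filter (fun x => X x = a)).sort (· ≤ ·)

/-- The operator `K a`: the balls of color `a`, taken successively from left to right, are moved
to the leftmost empty box to their right. -/
noncomputable def K {κ : ℕ} (a : Fin (κ + 1)) (X : Config κ) : Config κ :=
  (sites X a).foldl moveBall X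

/-- One time step `K 1 ∘ K 2 ∘ ⋯ ∘ K κ`: the balls of color `κ` move first, those of color `1`
last. -/
noncomputable def step {κ : ℕ} (X : Config κ) : Config κ :=
  (List.finRange κ).foldr (fun a Y => K a.succ Y) X

/-- The configuration at time `t` of the box-ball trajectory started at `X`. -/
noncomputable def trajectory {κ : ℕ} (X : Config κ) (t : ℕ) : Config κ :=
  step^[t] X

/-- The nonempty word `w` is read off the boxes `p, p + 1, …, p + w.length - 1` of `X`, all of
these boxes are occupied, the colors are non-increasing, and the block is maximal with these
properties. -/
structure IsBlock {κ : ℕ} (X : Config κ) (p : ℕ) (w : List (Fin (κ + 1))) : Prop where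
  ne_nil : w ≠ []
  read : ∀ (j : ℕ) (hj : j < w.length), X (p + j) = w[j]
  occupied : ∀ c ∈ w, c ≠ 0
  nonincreasing : w.Pairwise (fun c d => d ≤ c)
  left_maximal : ∀ q, q + 1 = p → X q = 0 ∨ X q < X p
  right_maximal : X (p + w.length) = 0 ∨ X (p + w.length - 1) < X (p + w.length)

/-- The maximal non-increasing blocks of consecutive balls of `X`, from left to right, are exactly
the words in the list `W`. -/
def HasBlocks {κ : ℕ} (X : Config κ) (W : List (List (Fin (κ + 1)))) : Prop :=
  ∃ p : Fin W.length → ℕ, StrictMono p ∧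
    (∀ i, IsBlock X (p i) (W.get i)) ∧
    ∀ x, X x ≠ 0 → ∃ i, p i ≤ x ∧ x < p i + (W.get i).length

/-- From time `T` on, the trajectory started at `X` is decomposed into the solitons `W`, listed
from left to right: lengths are non-decreasing from the left, and at every time `t ≥ T` the
blocks of the configuration are the same words `W`, so that length and content of every soliton
are preserved in all future steps. -/
def IsSolitonDecomposition {κ : ℕ} (X : Config κ) (T : ℕ)
    (W : List (List (Fin (κ + 1)))) : Prop :=
  (W.map List.length).Pairwise (· ≤ ·) ∧ ∀ t, T ≤ t → HasBlocks (trajectory X t) W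

/-- `Λ` is the Young diagram of the soliton decomposition of the trajectory started at `X`: its
`j`-th column is as long as the `j`-th longest soliton. (The solitons are listed in non-decreasing
order of length, so that the longest one is the last one.) -/
def IsSolitonDiagram {κ : ℕ} (X : Config κ) (Λ : YoungDiagram) : Prop :=
  ∃ (T : ℕ) (W : List (List (Fin (κ + 1)))), IsSolitonDecomposition X T W ∧
    ∀ j, Λ.colLen j = (W.map List.length).reverse.getD j 0

/-- The elements `b` of `A` that have a predecessor `a` in `A` with `X a < X b`. -/
def ascents {κ : ℕ} (A : Set ℕ) (X : Config κ) : Set ℕ :=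
  {b | b ∈ A ∧ ∃ a ∈ A, a < b ∧ (∀ c ∈ A, c < b → c ≤ a) ∧ X a < X b}

/-- There are only finitely many ascents, so that `Set.ncard` really counts them. -/
theorem ascents_finite {κ : ℕ} (A : Set ℕ) (X : Config κ) : (ascents A X).Finite := by
  refine X.support.finite_toSet.subset ?_
  rintro b ⟨-, a, -, -, -, hab⟩
  simpa using ((Fin.zero_le _).trans_lt hab).ne'

open Classical in
/-- The number of ascents of `X` in `A = {a₁ < a₂ < ⋯}`, where a first element `a₁` with
`X a₁ > 0` counts as an ascent (from the value `0`). -/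
noncomputable def NA {κ : ℕ} (A : Set ℕ) (X : Config κ) : ℕ :=
  (if ∃ a ∈ A, (∀ c ∈ A, a ≤ c) ∧ 0 < X a then 1 else 0) + (ascents A X).ncard

/-- The empty boxes `i` of `X` with `min A ≤ i ≤ max A`. -/
def gaps {κ : ℕ} (A : Finset ℕ) (X : Config κ) : Set ℕ :=
  {i | (∃ a ∈ A, a ≤ i) ∧ (∃ b ∈ A, i ≤ b) ∧ X i = 0}

open Classical in
/-- The penalized length of `A` with respect to `X`; it is `0` for `A = ∅`. -/
noncomputable def penalizedLength {κ : ℕ} (A : Finset ℕ) (X : Config κ) : ℤ :=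
  if ∀ a ∈ A, ∀ b ∈ A, a ≤ b → X b ≤ X a then (A.card : ℤ) - ((gaps A X).ncard : ℤ) else 0

/-- `max A < min B`. -/
def Precedes (A B : Finset ℕ) : Prop := ∀ a ∈ A, ∀ b ∈ B, a < b

end BoxBall

/-! The column sums are conserved by the dynamics and can be read off once the solitons are sorted;
the row sums then follow by a min-max duality.

Conservation. A time step is one passage of a carrier that picks up every ball it meets and releases
the largest color it may (`step_apply`). Let c(s,e) be the number of balls in front of box e in a
carrier that starts empty in front of box s. Then c(s,e) is the largest value of |A| minus the
number of empty boxes in [m,e), where s ≤ m ≤ e and A is a set of balls in [m,e) with non-increasing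
colors (`IsWindow.card_le`, `exists_isWindow_carrier`). One time step later, the largest value of
|B| minus the number of empty boxes in [s,d), over such sets B in [s,d) with d ≤ e, is D(s,e) =
c(0,s) + c(s,e) - c(0,e) (`card_add_size_le`, `exists_isWindow_release`, `size_add_size_le`). Along
successive cuts the terms c(0,·) telescope, so the maximal sum of l penalized lengths is the same
for `X` and `step X` (`isMaxSum_step_iff`).

Solitons. Blocks of `step X` start exactly where blocks of `X` end (`isStart_step_iff`), so the i-th
block moves by its own length. The number of balls of a given color from the start of the i-th block
onwards never decreases and is bounded, hence finally constant. From then on the words are fixed,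
and a longer block cannot stay to the left of a shorter one. The carrier then holds exactly as many
balls as the block at the end of which it stands, so l successive sets cannot beat the last l blocks
(`IsSorted.attains_le`). This gives the columns, and thereby the uniqueness of the diagram.

Duality. With N balls, k classes and l successive sets, the ascents and the penalized lengths sum to
at most N + kl (`sum_NA_add_le`); a greedy partition reaches this bound for some l
(`exists_partition`). The first k rows and l columns of a diagram with N cells obey the same
inequality, with equality when l is the length of the k-th row. Comparing the two gives the rows. -/

namespace BoxBall

/-! ### The carrier -/

/-- The color released by a carrier with contents `n` when it meets a box with content `x`: the
largest color in the carrier, among those smaller than `x` if `x` is a ball. -/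
noncomputable def release {κ : ℕ} (n : Fin (κ + 1) → ℕ) (x : Fin (κ + 1)) : Fin (κ + 1) :=
  (Finset.univ.filter fun a => 0 < n a ∧ (x = 0 ∨ a < x)).sup id

/-- The contents of the carrier after it met a box with content `x`. -/
noncomputable def load {κ : ℕ} (n : Fin (κ + 1) → ℕ) (x : Fin (κ + 1)) (a : Fin (κ + 1)) : ℕ :=
  if a = 0 then 0 else (n a + if a = x then 1 else 0) - if a = release n x then 1 else 0

/-- The contents in front of box `e` of a carrier which starts empty in front of box `s`. -/
noncomputable def carrier {κ : ℕ} (X : ℕ → Fin (κ + 1)) (s : ℕ) : ℕ → Fin (κ + 1) → ℕ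
  | 0 => 0
  | e + 1 => if e < s then 0 else load (carrier X s e) (X e)

/-- The number of balls in a carrier whose color satisfies `p`. -/
noncomputable def mass {κ : ℕ} (n : Fin (κ + 1) → ℕ) (p : Fin (κ + 1) → Prop) [DecidablePred p] : ℕ :=
  ∑ a with p a, n a

section

variable {κ : ℕ} {n : Fin (κ + 1) → ℕ} {x a : Fin (κ + 1)}

theorem le_release (ha : 0 < n a) (hx : x = 0 ∨ a < x) : a ≤ release n x :=
  Finset.le_sup (f := id) (by simp [ha, hx])

theorem release_mem (h : release n x ≠ 0) :
    0 < n (release n x) ∧ (x = 0 ∨ release n x < x) := by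
  have hne : (Finset.univ.filter fun a => 0 < n a ∧ (x = 0 ∨ a < x)).Nonempty := by
    by_contra hne
    rw [Finset.not_nonempty_iff_eq_empty] at hne
    exact h (by rw [release, hne]; rfl)
  obtain ⟨b, hb, hb'⟩ := Finset.exists_mem_eq_sup _ hne id
  simp only [Finset.mem_filter, Finset.mem_univ, true_and, id] at hb hb'
  rw [release, hb']
  exact hb

theorem release_lt (hx : x ≠ 0) : release n x < x := by
  by_cases h : release n x = 0
  · rw [h]; exact Fin.pos_of_ne_zero hx
  · exact (release_mem h).2.resolve_left hx

/-- The truncated subtraction in `load` loses nothing, because a released nonzero color was in the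
carrier before. -/
theorem load_add (ha : a ≠ 0) :
    load n x a + (if a = release n x then 1 else 0) = n a + if a = x then 1 else 0 := by
  rw [load, if_neg ha]
  by_cases h : a = release n x
  · have := (release_mem (n := n) (x := x) (h ▸ ha)).1
    rw [← h] at this
    simp only [h, if_true] at this ⊢
    omega
  · simp [h]

@[simp] theorem load_zero_apply : load n x 0 = 0 := by simp [load]

/-- Conservation of balls at one box. Color 0 stands for emptiness and has to be left out on both
sides, even if `p` holds for it. -/
theorem mass_load (hn : n 0 = 0) (p : Fin (κ + 1) → Prop) [DecidablePred p] :
    mass (load n x) p + (if release n x ≠ 0 ∧ p (release n x) then 1 else 0) =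
      mass n p + if x ≠ 0 ∧ p x then 1 else 0 := by
  have key : ∀ z : Fin (κ + 1), (if z ≠ 0 ∧ p z then 1 else 0) =
      ∑ a with p a, if a ≠ 0 ∧ a = z then 1 else 0 := by
    intro z
    by_cases hz : z ≠ 0 ∧ p z
    · rw [if_pos hz, Finset.sum_eq_single z]
      · simp [hz.1]
      · intro b _ hb; simp [hb]
      · intro h; simp [hz.2] at h
    · rw [if_neg hz, eq_comm]
      apply Finset.sum_eq_zero
      intro b hb
      rw [if_neg]
      rintro ⟨h0, rfl⟩
      exact hz ⟨h0, by simpa using hb⟩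
  rw [key, key, mass, mass, ← Finset.sum_add_distrib, ← Finset.sum_add_distrib]
  refine Finset.sum_congr rfl fun a _ => ?_
  by_cases ha : a = 0
  · subst ha; simp [hn]
  · simpa [ha] using load_add (n := n) (x := x) ha

theorem mass_mono {p q : Fin (κ + 1) → Prop} [DecidablePred p] [DecidablePred q]
    (h : ∀ a, n a ≠ 0 → p a → q a) : mass n p ≤ mass n q := by
  unfold mass
  rw [Finset.sum_filter, Finset.sum_filter]
  refine Finset.sum_le_sum fun a _ => ?_
  by_cases ha : n a = 0
  · simp [ha]
  · by_cases hp : p a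
    · simp [hp, h a ha hp]
    · simp [hp]

theorem mass_congr {p q : Fin (κ + 1) → Prop} [DecidablePred p] [DecidablePred q]
    (h : ∀ a, n a ≠ 0 → (p a ↔ q a)) : mass n p = mass n q :=
  le_antisymm (mass_mono fun a ha => (h a ha).1) (mass_mono fun a ha => (h a ha).2)

theorem mass_eq_zero {p : Fin (κ + 1) → Prop} [DecidablePred p]
    (h : ∀ a, p a → n a = 0) : mass n p = 0 :=
  Finset.sum_eq_zero fun a ha => h a (by simpa using ha)

theorem exists_of_mass_pos {p : Fin (κ + 1) → Prop} [DecidablePred p] (h : 0 < mass n p) :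
    ∃ a, p a ∧ 0 < n a := by
  by_contra! hc
  exact h.ne' (mass_eq_zero fun a ha => Nat.le_zero.1 (hc a ha))

end

section

variable {κ : ℕ} {X : ℕ → Fin (κ + 1)} {s e : ℕ}

theorem carrier_eq_zero (h : e ≤ s) : carrier X s e = 0 := by
  cases e with
  | zero => rfl
  | succ e => simp [carrier, show e < s by omega]

theorem carrier_succ (h : s ≤ e) : carrier X s (e + 1) = load (carrier X s e) (X e) := by
  simp [carrier, show ¬ e < s by omega]

@[simp] theorem carrier_apply_zero : carrier X s e 0 = 0 := by
  rcases le_or_gt e s with h | h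
  · simp [carrier_eq_zero h]
  · obtain ⟨e, rfl⟩ : ∃ f, e = f + 1 := ⟨e - 1, by omega⟩
    simp [carrier_succ (show s ≤ e by omega)]

end

/-! ### A time step is a passage of the carrier -/

/-- The number of balls of color `a` in the hands of a carrier in front of box `s`, if it picks up
the balls in the boxes `l` and drops a ball into each empty box. -/
def counter {κ : ℕ} (l : List ℕ) (Z : ℕ → Fin (κ + 1)) : ℕ → ℕ
  | 0 => 0
  | s + 1 => if s ∈ l then counter l Z s + 1 else
      if Z s = 0 then counter l Z s - 1 else counter l Z s

/-- The content of box `s` after the passage of the carrier of `counter`. -/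
def pass {κ : ℕ} (a : Fin (κ + 1)) (l : List ℕ) (Z : ℕ → Fin (κ + 1)) (s : ℕ) : Fin (κ + 1) :=
  if s ∈ l then 0 else if Z s = 0 ∧ 0 < counter l Z s then a else Z s

section

variable {κ : ℕ}

theorem moveBall_apply (Z : Config κ) (x s : ℕ) : moveBall Z x s =
    if s = nextEmpty Z x then Z x else if s = x then 0 else Z s := by
  simp only [moveBall, Finsupp.coe_update, Function.update_apply]

/-- Let y be the first empty box after x. If the ball in x joins the passage instead of being moved
beforehand, the carrier holds one more ball exactly in front of the boxes of (x, y], and this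
surplus is spent on y. -/
theorem pass_cons {a : Fin (κ + 1)} (ha : a ≠ 0) {x : ℕ} {l : List ℕ} {Z : Config κ}
    (hl : (x :: l).Pairwise (· < ·)) (hZ : ∀ z ∈ x :: l, Z z = a) (s : ℕ) :
    pass a l (moveBall Z x) s = pass a (x :: l) Z s := by
  obtain ⟨⟨hxy, hy⟩, hmin⟩ := nextEmpty_spec Z x
  have hmv := moveBall_apply Z x
  set y := nextEmpty Z x
  set Z' := moveBall Z x
  have hlt : ∀ z ∈ l, x < z := (List.pairwise_cons.1 hl).1
  have hZx : Z x = a := hZ x (by simp)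
  have hyl : y ∉ l := fun h => ha (by rw [← hZ y (by simp [h]), hy])
  have hbet : ∀ z, x < z → z < y → Z z ≠ 0 := fun z h1 h2 h3 => by
    have := hmin ⟨h1, h3⟩; omega
  have hc : ∀ s, counter (x :: l) Z s =
      counter l Z' s + (if x < s ∧ s ≤ y then 1 else 0) ∧ (s ≤ x → counter l Z' s = 0) := by
    intro s
    induction s with
    | zero => simp [counter]
    | succ s ih =>
      obtain ⟨ih, ih0⟩ := ih
      simp only [counter, List.mem_cons]
      rw [ih, hmv]
      rcases lt_trichotomy s x with h | rfl | h
      · have h1 : s ∉ l := fun h' => by have := hlt s h'; omega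
        simp [h1, h.ne, show s ≠ y by omega, show ¬ x < s by omega, show ¬ x < s + 1 by omega,
          ih0 h.le]
      · have h1 : s ∉ l := fun h' => by have := hlt s h'; omega
        simp [h1, hxy.ne, ih0 le_rfl, show s + 1 ≤ y by omega]
      · rcases lt_trichotomy s y with h2 | rfl | h2
        · have := hbet s h h2
          simp only [h.ne', h2.ne, this, h, h2.le, if_true, if_false, false_or, and_true,
            show x < s + 1 by omega, show s + 1 ≤ y by omega]
          refine ⟨?_, by omega⟩
          split_ifs <;> omega
        · simp [h.ne', hyl, hZx, ha, hy, h, show x < y + 1 by omega, show ¬ y + 1 ≤ x by omega]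
        · simp [h.ne', h2.ne', show ¬ s ≤ y by omega, show ¬ s + 1 ≤ y by omega,
            show ¬ s + 1 ≤ x by omega]
  unfold pass
  obtain ⟨hcs, hcs0⟩ := hc s
  rw [hcs, hmv]
  simp only [List.mem_cons]
  rcases lt_trichotomy s x with h | rfl | h
  · simp [h.ne, show s ≠ y by omega, show ¬ x < s by omega]
  · simp [hxy.ne, hcs0 le_rfl]
  · rcases lt_trichotomy s y with h2 | rfl | h2
    · simp [h.ne', h2.ne, hbet s h h2]
    · simp [h.ne', hyl, hZx, ha, hy, h]
    · simp [h.ne', h2.ne', show ¬ s ≤ y by omega]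

theorem foldl_moveBall {a : Fin (κ + 1)} (ha : a ≠ 0) {l : List ℕ} :
    ∀ {Z : Config κ}, l.Pairwise (· < ·) → (∀ z ∈ l, Z z = a) →
      ∀ s, l.foldl moveBall Z s = pass a l Z s := by
  induction l with
  | nil =>
    intro Z _ _ s
    have : ∀ s, counter [] (Z : ℕ → Fin (κ + 1)) s = 0 := by
      intro s; induction s with
      | zero => rfl
      | succ s ih => simp [counter, ih]
    simp [pass, this]
  | cons x l ih =>
    intro Z hl hZ s
    rw [List.foldl_cons, ih (List.pairwise_cons.1 hl).2, pass_cons ha hl hZ]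
    intro z hz
    have hxz := (List.pairwise_cons.1 hl).1 z hz
    have hzy : z ≠ nextEmpty Z x := by
      intro h
      have := (nextEmpty_spec Z x).1.2
      rw [← h, hZ z (by simp [hz])] at this
      exact ha this
    rw [moveBall_apply, if_neg hzy, if_neg (by omega), hZ z (by simp [hz])]

theorem mem_sites {a : Fin (κ + 1)} (ha : a ≠ 0) {Z : Config κ} {s : ℕ} :
    s ∈ sites Z a ↔ Z s = a := by
  simp only [sites, Finset.mem_sort, Finset.mem_filter, Finsupp.mem_support_iff]
  exact ⟨fun h => h.2, fun h => ⟨by rwa [h], h⟩⟩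

theorem K_apply {a : Fin (κ + 1)} (ha : a ≠ 0) (Z : Config κ) (s : ℕ) :
    K a Z s = pass a (sites Z a) Z s :=
  foldl_moveBall ha (Finset.sortedLT_sort _).pairwise (fun _ h => (mem_sites ha).1 h) s

/-- The content of a box after the balls of color larger than `j` have moved: `x` was its content,
and `n` are the contents of the carrier. -/
noncomputable def releaseAbove (j : ℕ) (n : Fin (κ + 1) → ℕ) (x : Fin (κ + 1)) : Fin (κ + 1) :=
  if x ≠ 0 ∧ (x : ℕ) ≤ j then x else if j < (release n x : ℕ) then release n x else 0

/-- Downward induction on the color that moves next: dropping `j` entries leaves the colors above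
`j`. Each operator `K a` is a passage of a one-color carrier, and the many-color carrier runs all of
these at once, larger colors having the first choice of a box. -/
theorem foldr_K_apply (X : Config κ) (m : ℕ) : ∀ j, j + m = κ → ∀ s,
    ((List.finRange κ).drop j).foldr (fun a Y => K a.succ Y) X s =
      releaseAbove j (carrier X 0 s) (X s) := by
  induction m with
  | zero =>
    intro j hj s
    rw [List.drop_of_length_le (by simp; omega), List.foldr_nil, releaseAbove]
    have h1 : ((X s : Fin (κ + 1)) : ℕ) ≤ j := by have := (X s).is_lt; omega
    have h2 : ¬ j < (release (carrier X 0 s) (X s) : ℕ) := by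
      have := (release (carrier X 0 s) (X s)).is_lt; omega
    rw [if_neg h2]
    by_cases h : X s = 0 <;> simp [h, h1]
  | succ m ih =>
    intro j hj s
    have hjl : j < (List.finRange κ).length := by simp; omega
    rw [List.drop_eq_getElem_cons hjl, List.foldr_cons]
    set Z := ((List.finRange κ).drop (j + 1)).foldr (fun a Y => K a.succ Y) X with hZdef
    have hZ : ∀ s, Z s = releaseAbove (j + 1) (carrier X 0 s) (X s) := ih (j + 1) (by omega)
    obtain ⟨a, ha, ha0⟩ : ∃ a : Fin (κ + 1), (a : ℕ) = j + 1 ∧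
        ((List.finRange κ)[j]).succ = a :=
      ⟨((List.finRange κ)[j]).succ, by simp, rfl⟩
    rw [ha0]
    have hane : a ≠ 0 := by intro h; simp [h] at ha
    have hZa : ∀ s, Z s = a ↔ X s = a := by
      intro s
      rw [hZ, releaseAbove]
      split_ifs with h1 h2
      · rfl
      · constructor
        · intro h; rw [h] at h2; omega
        · intro h; exact (h1 ⟨h ▸ hane, by rw [h]; omega⟩).elim
      · constructor
        · intro h; exact (hane h.symm).elim
        · intro h; exact (h1 ⟨h ▸ hane, by rw [h]; omega⟩).elim
    -- A box is free for color `a` once the larger colors have moved: it was empty or has been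
    -- vacated, and no larger color was dropped into it.
    have hZ0 : ∀ s, Z s = 0 ↔ ((X s = 0 ∨ a < X s) ∧ release (carrier X 0 s) (X s) ≤ a) := by
      intro s
      rw [hZ, releaseAbove]
      split_ifs with h1 h2
      · simp only [h1.1, false_or, false_iff, not_and]
        intro h; rw [Fin.lt_def] at h; omega
      · have : ¬ release (carrier X 0 s) (X s) ≤ a := by rw [Fin.le_def]; omega
        simp only [this, and_false, iff_false]
        intro h; simp [h] at h2
      · simp only [true_iff]
        refine ⟨?_, by rw [Fin.le_def]; omega⟩
        by_contra! hc
        exact h1 ⟨hc.1, by have := hc.2; rw [Fin.le_def] at this; omega⟩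
    -- At a free box the one-color carrier drops a ball if it has one, and in that case `a` is
    -- precisely the largest color that may be released there.
    have hc : ∀ s, counter (sites Z a) Z s = carrier X 0 s a := by
      intro s
      induction s with
      | zero => rfl
      | succ s ihs =>
        rw [counter, carrier_succ (Nat.zero_le s), ihs]
        simp only [mem_sites hane, hZa, hZ0, load, if_neg hane]
        set n := carrier X 0 s
        by_cases h1 : X s = a
        · have : a ≠ release n a := (release_lt hane).ne'
          simp [h1, this]
        · rw [if_neg h1, if_neg (show ¬ a = X s from fun h => h1 h.symm)]
          by_cases h2 : a = release n (X s)
          · have := (release_mem (n := n) (x := X s) (h2 ▸ hane)).2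
            rw [← h2] at this
            simp [← h2, this]
          · rw [if_neg h2]
            by_cases h3 : (X s = 0 ∨ a < X s) ∧ release n (X s) ≤ a
            · have : n a = 0 := by
                by_contra h
                exact h2 (le_antisymm (le_release (Nat.pos_of_ne_zero h) h3.1) h3.2)
              simp [this]
            · simp [h3]
    rw [K_apply hane]
    unfold pass
    rw [hc, releaseAbove]
    simp only [mem_sites hane, hZa, hZ0]
    set n := carrier X 0 s
    by_cases h1 : X s = a
    · rw [if_pos h1, h1, if_neg (by omega), if_neg]
      have := release_lt (n := n) hane
      rw [Fin.lt_def] at this; omega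
    · rw [if_neg h1]
      have h1' : (X s : ℕ) ≠ j + 1 := fun h => h1 (Fin.ext (by omega))
      by_cases h2 : X s ≠ 0 ∧ (X s : ℕ) ≤ j
      · rw [if_pos h2, if_neg, hZ, releaseAbove, if_pos ⟨h2.1, by omega⟩]
        rintro ⟨⟨h | h, -⟩, -⟩
        · exact h2.1 h
        · rw [Fin.lt_def] at h; omega
      · have h3 : X s = 0 ∨ a < X s := by
          by_contra! hc'
          have := hc'.2
          rw [Fin.le_def] at this
          exact h2 ⟨hc'.1, by omega⟩
        have h4 : ¬ (X s ≠ 0 ∧ (X s : ℕ) ≤ j + 1) := by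
          rintro ⟨h5, h6⟩; exact h2 ⟨h5, by omega⟩
        rw [if_neg h2, hZ, releaseAbove, if_neg h4]
        rcases lt_trichotomy (release n (X s) : ℕ) (j + 1) with h | h | h
        · rw [if_neg (by omega : ¬ j < (release n (X s) : ℕ)),
            if_neg (by omega : ¬ j + 1 < (release n (X s) : ℕ)), if_neg]
          rintro ⟨-, h5⟩
          have := le_release h5 h3
          rw [Fin.le_def] at this; omega
        · have h5 : release n (X s) = a := Fin.ext (by omega)
          have := (release_mem (n := n) (x := X s) (h5 ▸ hane)).1
          rw [h5] at this
          rw [if_pos ⟨⟨h3, h5.le⟩, this⟩, if_pos (by omega), h5]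
        · rw [if_pos (by omega : j < (release n (X s) : ℕ)), if_pos h, if_neg]
          rintro ⟨⟨-, h5⟩, -⟩
          rw [Fin.le_def] at h5; omega

/-- A time step is a passage of the carrier. -/
theorem step_apply (X : Config κ) (s : ℕ) : step X s = release (carrier X 0 s) (X s) := by
  have := foldr_K_apply X κ 0 (by omega) s
  rw [List.drop_zero] at this
  rw [step, this, releaseAbove, if_neg (fun h => h.1 (Fin.ext (Nat.le_zero.1 h.2)))]
  split_ifs with h
  · rfl
  · exact (Fin.ext (Nat.le_zero.1 (not_lt.1 h))).symm

end

/-! ### Windows and the size of the carrier -/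

/-- The total number of balls in a carrier. -/
def size {κ : ℕ} (n : Fin (κ + 1) → ℕ) : ℕ := ∑ a, n a

/-- The number of empty boxes in `[m, e)`. -/
def zeros {κ : ℕ} (X : ℕ → Fin (κ + 1)) (m e : ℕ) : ℕ :=
  ((Finset.Ico m e).filter fun i => X i = 0).card

/-- `A` is a set of balls in `[m, e)`, of colors at least `v`, along which the colors are
non-increasing. -/
structure IsWindow {κ : ℕ} (X : ℕ → Fin (κ + 1)) (v : Fin (κ + 1)) (m e : ℕ) (A : Finset ℕ) :
    Prop where
  mem : ∀ a ∈ A, m ≤ a ∧ a < e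
  ne_zero : ∀ a ∈ A, X a ≠ 0
  le : ∀ a ∈ A, v ≤ X a
  anti : ∀ a ∈ A, ∀ b ∈ A, a ≤ b → X b ≤ X a

section

variable {κ : ℕ} {X : ℕ → Fin (κ + 1)} {v : Fin (κ + 1)} {m e : ℕ} {A : Finset ℕ}

theorem isWindow_empty : IsWindow X v m e ∅ := by constructor <;> simp

theorem IsWindow.eq_empty (h : IsWindow X v m e A) (hme : e ≤ m) : A = ∅ := by
  rw [Finset.eq_empty_iff_forall_notMem]
  intro a ha; have := h.mem a ha; omega

theorem IsWindow.mono (h : IsWindow X v m e A) {v' : Fin (κ + 1)} {m' e' : ℕ} (hv : v' ≤ v)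
    (hm : m' ≤ m) (he : e ≤ e') : IsWindow X v' m' e' A :=
  ⟨fun a ha => by have := h.mem a ha; omega, h.ne_zero, fun a ha => hv.trans (h.le a ha), h.anti⟩

theorem IsWindow.of_notMem (h : IsWindow X v m (e + 1) A) (he : e ∉ A) : IsWindow X v m e A :=
  ⟨fun a ha => by
    have := h.mem a ha
    have : a ≠ e := fun h => he (h ▸ ha)
    omega, h.ne_zero, h.le, h.anti⟩

theorem IsWindow.erase (h : IsWindow X v m (e + 1) A) (he : e ∈ A) :
    IsWindow X (X e) m e (A.erase e) := by
  have hlt : ∀ a ∈ A.erase e, m ≤ a ∧ a < e := fun a ha => by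
    have := h.mem a (Finset.mem_of_mem_erase ha)
    have := Finset.ne_of_mem_erase ha
    omega
  exact ⟨hlt, fun a ha => h.ne_zero a (Finset.mem_of_mem_erase ha),
    fun a ha => h.anti a (Finset.mem_of_mem_erase ha) e he (hlt a ha).2.le,
    fun a ha b hb => h.anti a (Finset.mem_of_mem_erase ha) b (Finset.mem_of_mem_erase hb)⟩

theorem IsWindow.insert (h : IsWindow X (X e) m e A) (hm : m ≤ e) (he : X e ≠ 0)
    (hv : v ≤ X e) : IsWindow X v m (e + 1) (insert e A) ∧ (insert e A).card = A.card + 1 := by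
  refine ⟨⟨?_, ?_, ?_, ?_⟩, Finset.card_insert_of_notMem fun h' => ?_⟩
  · intro a ha
    rcases Finset.mem_insert.1 ha with rfl | ha
    · omega
    · have := h.mem a ha; omega
  · intro a ha
    rcases Finset.mem_insert.1 ha with rfl | ha
    · exact he
    · exact h.ne_zero a ha
  · intro a ha
    rcases Finset.mem_insert.1 ha with rfl | ha
    · exact hv
    · exact hv.trans (h.le a ha)
  · intro a ha b hb hab
    rcases Finset.mem_insert.1 ha with ha | ha <;> rcases Finset.mem_insert.1 hb with hb | hb
    · rw [ha, hb]
    · have := h.mem b hb; omega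
    · rw [hb]; exact h.le a ha
    · exact h.anti a ha b hb hab
  · have := h.mem e h'; omega

theorem zeros_succ (h : m ≤ e) :
    zeros X m (e + 1) = zeros X m e + if X e = 0 then 1 else 0 := by
  unfold zeros
  rw [← Finset.insert_Ico_right_eq_Ico_add_one h, Finset.filter_insert]
  split_ifs with h1
  · rw [Finset.card_insert_of_notMem (by simp)]
  · rfl

theorem zeros_of_le (h : e ≤ m) : zeros X m e = 0 := by
  simp [zeros, Finset.Ico_eq_empty_of_le h]

end

section

variable {κ : ℕ} {n m : Fin (κ + 1) → ℕ} {x v : Fin (κ + 1)}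

theorem mass_eq_size {p : Fin (κ + 1) → Prop} [DecidablePred p] (h : ∀ a, p a) :
    mass n p = size n := by simp [mass, size, h]

theorem size_load (hn : n 0 = 0) :
    size (load n x) + (if release n x ≠ 0 then 1 else 0) = size n + if x ≠ 0 then 1 else 0 := by
  simpa [mass_eq_size] using mass_load (x := x) hn (fun _ => True)

theorem release_mono (h : ∀ a, n a ≤ m a) : release n x ≤ release m x := by
  by_cases h0 : release n x = 0
  · rw [h0]; exact Fin.zero_le _
  · obtain ⟨h1, h2⟩ := release_mem h0
    exact le_release (h1.trans_le (h _)) h2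

/-- Only a color released by the larger carrier could violate the order. If the smaller carrier has
a ball of that color too, it must release the same one, since its release is no larger. -/
theorem load_mono (h : ∀ a, n a ≤ m a) (a : Fin (κ + 1)) : load n x a ≤ load m x a := by
  by_cases ha : a = 0
  · simp [ha]
  · have h1 := load_add (n := n) (x := x) ha
    have h2 := load_add (n := m) (x := x) ha
    have h3 := h a
    by_cases hm : a = release m x
    · obtain ⟨h4, h5⟩ := release_mem (hm ▸ ha)
      rw [← hm] at h4 h5
      have h6 : a ≠ x := by
        rcases h5 with h5 | h5
        · exact h5 ▸ ha
        · exact h5.ne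
      rw [if_pos hm, if_neg h6] at h2
      rw [if_neg h6] at h1
      split_ifs at h1 with h7
      · omega
      · have : n a = 0 := by
          by_contra h8
          exact h7 (le_antisymm (le_release (Nat.pos_of_ne_zero h8) h5)
            (hm ▸ release_mono h))
        omega
    · rw [if_neg hm] at h2
      omega

end

section

variable {κ : ℕ} {X : ℕ → Fin (κ + 1)} {s e : ℕ}

theorem carrier_le (s e : ℕ) (a : Fin (κ + 1)) : carrier X s e a ≤ carrier X 0 e a := by
  induction e generalizing a with
  | zero => simp [carrier_eq_zero]
  | succ e ih =>
    rcases Nat.lt_or_ge e s with h | h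
    · simp [carrier_eq_zero (show e + 1 ≤ s by omega)]
    · rw [carrier_succ h, carrier_succ (Nat.zero_le _)]
      exact load_mono ih a

/-- A window is at most as long as the load that it leaves in the carrier. -/
theorem IsWindow.card_le {v : Fin (κ + 1)} {m : ℕ} {A : Finset ℕ} (hs : s ≤ m)
    (hA : IsWindow X v m e A) :
    A.card ≤ mass (carrier X s e) (v ≤ ·) + zeros X m e := by
  induction e generalizing v A with
  | zero => simp [hA.eq_empty (Nat.zero_le _)]
  | succ e ih =>
    rcases Nat.lt_or_ge e m with h | h
    · simp [hA.eq_empty h]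
    rw [carrier_succ (hs.trans h), zeros_succ h]
    have hml := mass_load (x := X e) (carrier_apply_zero (X := X) (s := s) (e := e)) (v ≤ ·)
    by_cases he : e ∈ A
    · have h0 := hA.ne_zero e he
      have h1 := ih (hA.erase he)
      rw [Finset.card_erase_of_mem he] at h1
      -- The ball released in exchange is smaller than `X e`, so the stock of colors at least `X e`
      -- grows by one, like the window.
      have h2 := mass_load (x := X e) (carrier_apply_zero (X := X) (s := s) (e := e)) (X e ≤ ·)
      rw [if_neg (fun h => (release_lt h0).not_ge h.2), if_pos ⟨h0, le_rfl⟩] at h2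
      have h3 : mass (load (carrier X s e) (X e)) (X e ≤ ·) ≤
        mass (load (carrier X s e) (X e)) (v ≤ ·) := mass_mono fun a _ h => (hA.le e he).trans h
      omega
    · have h1 := ih (hA.of_notMem he)
      by_cases h0 : X e = 0
      · simp only [h0, if_true] at hml ⊢
        split_ifs at hml <;> simp at hml <;> omega
      · have h2 := release_lt (n := carrier X s e) h0
        rw [if_neg h0]
        by_cases h3 : release (carrier X s e) (X e) ≠ 0 ∧ v ≤ release (carrier X s e) (X e)
        · rw [if_pos h3, if_pos ⟨h0, h3.2.trans h2.le⟩] at hml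
          omega
        · rw [if_neg h3] at hml
          omega

/-- The load of a carrier comes from a window. -/
theorem exists_isWindow_carrier (he : s ≤ e) (v : Fin (κ + 1)) : ∃ m A, s ≤ m ∧ m ≤ e ∧
    IsWindow X v m e A ∧ mass (carrier X s e) (v ≤ ·) + zeros X m e ≤ A.card := by
  induction e, he using Nat.le_induction generalizing v with
  | base => exact ⟨s, ∅, le_rfl, le_rfl, isWindow_empty,
      by simp [carrier_eq_zero, zeros_of_le, mass]⟩
  | succ e hse ih =>
    rw [carrier_succ hse]
    have hn0 := carrier_apply_zero (X := X) (s := s) (e := e)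
    have hml := mass_load (x := X e) hn0 (v ≤ ·)
    set n := carrier X s e
    set y := release n (X e) with hy
    by_cases h0 : X e = 0
    · rw [if_neg (show ¬ (X e ≠ 0 ∧ v ≤ X e) from fun h => h.1 h0)] at hml
      -- If no color at least `v` is left, an empty window restarted at `e + 1` discards all earlier
      -- empty boxes. Otherwise a ball of color at least `v` has just been dropped, which pays for
      -- the empty box `e`.
      rcases Nat.eq_zero_or_pos (mass (load n (X e)) (v ≤ ·)) with hz | hz
      · exact ⟨e + 1, ∅, by omega, le_rfl, isWindow_empty, by simp [hz, zeros_of_le]⟩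
      · obtain ⟨a, hva, ha⟩ := exists_of_mass_pos hz
        have ha0 : a ≠ 0 := by rintro rfl; simp at ha
        have hla := load_add (n := n) (x := X e) ha0
        rw [if_neg (show ¬ a = X e from fun h => ha0 (h.trans h0))] at hla
        have hay : a ≤ y := le_release (by omega) (Or.inl h0)
        have hy0 : y ≠ 0 := fun h => ha0 (Fin.le_zero_iff.1 (h ▸ hay))
        rw [if_pos (show y ≠ 0 ∧ v ≤ y from ⟨hy0, hva.trans hay⟩)] at hml
        obtain ⟨m, A, hm1, hm2, hA, hc⟩ := ih v
        refine ⟨m, A, hm1, by omega, hA.mono le_rfl le_rfl (by omega), ?_⟩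
        rw [zeros_succ hm2, if_pos h0]
        omega
    · by_cases hvx : v ≤ X e
      · rw [if_pos (show X e ≠ 0 ∧ v ≤ X e from ⟨h0, hvx⟩)] at hml
        by_cases hyv : y ≠ 0 ∧ v ≤ y
        · rw [if_pos hyv] at hml
          obtain ⟨m, A, hm1, hm2, hA, hc⟩ := ih v
          refine ⟨m, A, hm1, by omega, hA.mono le_rfl le_rfl (by omega), ?_⟩
          rw [zeros_succ hm2, if_neg h0]
          omega
        · rw [if_neg hyv] at hml
          obtain ⟨m, A, hm1, hm2, hA, hc⟩ := ih (X e)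
          obtain ⟨hB, hBc⟩ := hA.insert hm2 h0 hvx
          refine ⟨m, _, hm1, by omega, hB, ?_⟩
          -- A color of the carrier in the range from `v` to below `X e` would have forced the
          -- release of a color at least `v`.
          have : mass n (v ≤ ·) = mass n (X e ≤ ·) := by
            refine mass_congr fun a ha => ⟨fun hva => ?_, hvx.trans⟩
            by_contra! hax
            have hay : a ≤ y := le_release (Nat.pos_of_ne_zero ha) (Or.inr hax)
            refine hyv ⟨fun h => ?_, hva.trans hay⟩
            rw [h, Fin.le_zero_iff] at hay
            exact ha (hay ▸ hn0)
          rw [zeros_succ hm2, if_neg h0, hBc]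
          omega
      · rw [if_neg (show ¬ (X e ≠ 0 ∧ v ≤ X e) from fun h => hvx h.2),
          if_neg (show ¬ (y ≠ 0 ∧ v ≤ y) from fun h => hvx (h.2.trans (release_lt h0).le))] at hml
        obtain ⟨m, A, hm1, hm2, hA, hc⟩ := ih v
        refine ⟨m, A, hm1, by omega, hA.mono le_rfl le_rfl (by omega), ?_⟩
        rw [zeros_succ hm2, if_neg h0]
        omega

end

/-! ### Windows of the released configuration

The carrier started in front of box `s` and the carrier started in front of box `0` are compared;
the difference of their loads measures the windows of the released configuration. -/

section

variable {κ : ℕ} {X Y : ℕ → Fin (κ + 1)} {s e : ℕ} {v : Fin (κ + 1)}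

/-- The difference of the size and the mass of the carrier from `s` counts its balls of color above
`v`; for `v = 0` it is c(s,e), and the bound becomes D(s,e). The threshold is needed for the
induction: removing the last ball of `B` raises it to the color of that ball. -/
theorem card_add_size_le (hY : ∀ i, Y i = release (carrier X 0 i) (X i)) (hse : s ≤ e)
    {B : Finset ℕ} (hB : IsWindow Y v s e B) :
    B.card + size (carrier X 0 e) + mass (carrier X s e) (· ≤ v) ≤
      zeros Y s e + size (carrier X 0 s) + size (carrier X s e) := by
  induction e, hse using Nat.le_induction generalizing v B with
  | base => simp [hB.eq_empty le_rfl, carrier_eq_zero, mass, zeros_of_le]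
  | succ e hse ih =>
    rw [carrier_succ hse, carrier_succ (Nat.zero_le _), zeros_succ hse]
    have hn0 := carrier_apply_zero (X := X) (s := s) (e := e)
    have hm0 := carrier_apply_zero (X := X) (s := 0) (e := e)
    have hle := carrier_le (X := X) s e
    have hzy := release_mono (x := X e) hle
    have h1 := size_load (x := X e) hn0
    have h2 := size_load (x := X e) hm0
    have h3 := mass_load (x := X e) hn0 (· ≤ v)
    have hy := hY e
    rw [← hy] at hzy h2
    generalize hn : carrier X s e = n at *
    generalize hz : release n (X e) = z at *
    by_cases hx : X e = 0
    · rw [if_neg (show ¬ X e ≠ 0 by simp [hx])] at h1 h2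
      rw [if_neg (show ¬ (X e ≠ 0 ∧ X e ≤ v) by simp [hx])] at h3
      by_cases he : e ∈ B
      · have hye := hB.ne_zero e he
        have hvy := hB.le e he
        have ih := ih (hB.erase he)
        rw [Finset.card_erase_of_mem he] at ih
        have hc := Finset.card_pos.2 ⟨e, he⟩
        rw [if_pos hye] at h2
        rw [if_neg hye]
        have hm1 : mass n (· ≤ v) ≤ mass n (· ≤ Y e) := mass_mono fun a _ h => h.trans hvy
        by_cases hz0 : z = 0
        · rw [if_neg (by simp [hz0])] at h1
          rw [if_neg (by simp [hz0])] at h3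
          omega
        · rw [if_pos hz0] at h1
          -- Since `z ≤ Y e`, the number of balls of color above `Y e` in the carrier from `s` does
          -- not change.
          have h4 := mass_load (x := X e) hn0 (· ≤ Y e)
          rw [hz, if_pos ⟨hz0, hzy⟩, if_neg (by simp [hx])] at h4
          have hm2 : mass (load n (X e)) (· ≤ v) ≤ mass (load n (X e)) (· ≤ Y e) :=
            mass_mono fun a _ h => h.trans hvy
          omega
      · have ih := ih (hB.of_notMem he)
        by_cases hz0 : z = 0
        · rw [if_neg (by simp [hz0])] at h1
          rw [if_neg (by simp [hz0])] at h3
          by_cases hye : Y e = 0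
          · simp only [hye, ne_eq, not_true, if_true, if_false] at h2 ⊢
            omega
          · simp only [hye, ne_eq, not_false_eq_true, if_true, if_false] at h2 ⊢
            omega
        · have hye : Y e ≠ 0 := fun h => hz0 (Fin.le_zero_iff.1 (h ▸ hzy))
          rw [if_pos hye] at h2
          rw [if_pos hz0] at h1
          rw [if_neg hye]
          omega
    · have hyx : Y e < X e := hy ▸ release_lt hx
      rw [if_pos hx] at h1 h2
      by_cases he : e ∈ B
      · have hye := hB.ne_zero e he
        have hvy := hB.le e he
        have ih := ih (hB.erase he)
        rw [Finset.card_erase_of_mem he] at ih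
        have hc := Finset.card_pos.2 ⟨e, he⟩
        rw [if_pos hye] at h2
        rw [if_neg hye]
        rw [if_neg (show ¬ (X e ≠ 0 ∧ X e ≤ v) from fun h => (hvy.trans_lt hyx).not_ge h.2)] at h3
        have hm1 : mass n (· ≤ v) ≤ mass n (· ≤ Y e) := mass_mono fun a _ h => h.trans hvy
        by_cases hz0 : z = 0
        · rw [if_neg (by simp [hz0])] at h1
          rw [if_neg (by simp [hz0])] at h3
          omega
        · rw [if_pos hz0] at h1
          have h4 := mass_load (x := X e) hn0 (· ≤ Y e)
          rw [hz, if_pos ⟨hz0, hzy⟩, if_neg (fun h => hyx.not_ge h.2)] at h4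
          have hm2 : mass (load n (X e)) (· ≤ v) ≤ mass (load n (X e)) (· ≤ Y e) :=
            mass_mono fun a _ h => h.trans hvy
          omega
      · have ih := ih (hB.of_notMem he)
        by_cases hz0 : z = 0
        · rw [if_neg (by simp [hz0])] at h1
          rw [if_neg (by simp [hz0])] at h3
          by_cases hye : Y e = 0
          · simp only [hye, ne_eq, not_true, if_true, if_false] at h2 ⊢
            split_ifs at h3 <;> omega
          · simp only [hye, ne_eq, not_false_eq_true, if_true, if_false] at h2 ⊢
            split_ifs at h3 <;> omega
        · have hye : Y e ≠ 0 := fun h => hz0 (Fin.le_zero_iff.1 (h ▸ hzy))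
          rw [if_pos hye] at h2
          rw [if_pos hz0] at h1
          rw [if_neg hye]
          by_cases hxv : X e ≤ v
          · rw [if_pos (show X e ≠ 0 ∧ X e ≤ v from ⟨hx, hxv⟩),
              if_pos (show z ≠ 0 ∧ z ≤ v from ⟨hz0, hzy.trans (hyx.le.trans hxv)⟩)] at h3
            omega
          · rw [if_neg (show ¬ (X e ≠ 0 ∧ X e ≤ v) from fun h => hxv h.2)] at h3
            omega

/-- The reverse of `card_add_size_le`. The surplus of color `v` in the carrier from 0 is the
information that can be traced back box by box; when box `e` joins the window, the traced color
changes from `v` to `Y e`. -/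
theorem exists_isWindow_of_carrier_lt (hY : ∀ i, Y i = release (carrier X 0 i) (X i))
    (hse : s ≤ e) (hv : carrier X s e v < carrier X 0 e v) :
    ∃ B, IsWindow Y v s e B ∧
      zeros Y s e + size (carrier X 0 s) + size (carrier X s e) ≤
        B.card + size (carrier X 0 e) + mass (carrier X s e) (· ≤ v) := by
  induction e, hse using Nat.le_induction generalizing v with
  | base => exact ⟨∅, isWindow_empty, by simp [carrier_eq_zero, size, zeros_of_le]⟩
  | succ e hse ih =>
    have hv0 : v ≠ 0 := by rintro rfl; simp at hv
    rw [carrier_succ hse, carrier_succ (Nat.zero_le _)] at hv ⊢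
    rw [zeros_succ hse]
    have hn0 := carrier_apply_zero (X := X) (s := s) (e := e)
    have hm0 := carrier_apply_zero (X := X) (s := 0) (e := e)
    have hle := carrier_le (X := X) s e
    have hzy := release_mono (x := X e) hle
    have h1 := size_load (x := X e) hn0
    have h2 := size_load (x := X e) hm0
    have h3 := mass_load (x := X e) hn0 (· ≤ v)
    have hy := hY e
    have hln := load_add (n := carrier X s e) (x := X e) hv0
    have hlm := load_add (n := carrier X 0 e) (x := X e) hv0
    have hleM : ∀ a, 0 < carrier X 0 e a → (X e = 0 ∨ a < X e) → a ≤ Y e :=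
      fun a h h' => hy ▸ le_release h h'
    have hYm : Y e ≠ 0 → 0 < carrier X 0 e (Y e) ∧ (X e = 0 ∨ Y e < X e) :=
      fun h => hy ▸ release_mem (hy ▸ h)
    rw [← hy] at hzy h2 hlm
    have hleN : ∀ a, 0 < carrier X s e a → (X e = 0 ∨ a < X e) →
      a ≤ release (carrier X s e) (X e) := fun a h h' => le_release h h'
    generalize hz : release (carrier X s e) (X e) = z at *
    generalize hn : carrier X s e = n at *
    generalize hm : carrier X 0 e = m at *
    have hwin : ∀ {w} {B : Finset ℕ}, IsWindow Y w s e B → IsWindow Y w s (e + 1) B :=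
      fun h => h.mono le_rfl le_rfl (Nat.le_succ e)
    by_cases hye : Y e = 0
    · have hz0 : z = 0 := Fin.le_zero_iff.1 (hye ▸ hzy)
      rw [if_neg (fun h => hv0 (h.trans hz0))] at hln
      rw [if_neg (fun h => hv0 (h.trans hye))] at hlm
      obtain ⟨B, hB, hBc⟩ := ih (v := v) (by omega)
      refine ⟨B, hwin hB, ?_⟩
      have hmv : 0 < m v ∨ v = X e := by
        by_contra! hc
        rw [if_neg hc.2] at hlm; omega
      -- Otherwise the carrier from 0 could have released a ball of color `v` here.
      have hx : X e ≠ 0 ∧ X e ≤ v := by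
        by_contra hc
        rcases hmv with hmv | hmv
        · refine hv0 (Fin.le_zero_iff.1 (hye ▸ hleM v hmv ?_))
          by_contra! hc'
          exact hc ⟨hc'.1, hc'.2⟩
        · exact hc ⟨hmv ▸ hv0, hmv.ge⟩
      rw [if_pos hx.1] at h1 h2
      rw [if_pos hx, if_neg (by simp [hz0])] at h3
      rw [if_neg (by simp [hz0])] at h1
      rw [if_neg (by simp [hye])] at h2
      rw [if_pos hye]
      omega
    · obtain ⟨hmy, hyx⟩ := hYm hye
      rw [if_neg hye]
      rw [if_pos hye] at h2
      by_cases hxv : X e ≠ 0 ∧ X e ≤ v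
      · have hyv : Y e < v := (hyx.resolve_left hxv.1).trans_le hxv.2
        rw [if_neg (hzy.trans_lt hyv).ne'] at hln
        rw [if_neg hyv.ne'] at hlm
        obtain ⟨B, hB, hBc⟩ := ih (v := v) (by omega)
        refine ⟨B, hwin hB, ?_⟩
        rw [if_pos hxv] at h3
        rw [if_pos hxv.1] at h1 h2
        by_cases hz0 : z = 0
        · rw [if_neg (by simp [hz0])] at h1 h3
          omega
        · rw [if_pos hz0] at h1
          rw [if_pos ⟨hz0, hzy.trans hyv.le⟩] at h3
          omega
      · have hxv' : X e = 0 ∨ v < X e := by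
          by_contra! hc
          exact hxv hc
        have hvx : v ≠ X e := by
          rintro h
          rcases hxv' with h' | h'
          · exact hv0 (h.trans h')
          · exact h'.ne h
        rw [if_neg hvx] at hln hlm
        rw [if_neg hxv] at h3
        have hvy : v ≤ Y e := hleM v (by omega) hxv'
        -- If both carriers release colors above `v`, the surplus of `v` is older and the window is
        -- kept. Otherwise box `e` joins the window.
        by_cases hvz : v < z
        · rw [if_neg hvz.ne] at hln
          rw [if_neg (hvz.trans_le hzy).ne] at hlm
          obtain ⟨B, hB, hBc⟩ := ih (v := v) (by omega)
          refine ⟨B, hwin hB, ?_⟩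
          rw [if_neg (fun h => hvz.not_ge h.2)] at h3
          rw [if_pos (show z ≠ 0 from fun h => by simp [h] at hvz)] at h1
          omega
        · rw [not_lt] at hvz
          -- Either both carriers release the same color, which is then `v`, or the carrier from 0
          -- releases a larger color, which the carrier from `s` cannot have.
          have hny : n (Y e) < m (Y e) := by
            rcases hzy.eq_or_lt with h | h
            · have : v = Y e := le_antisymm hvy (h ▸ hvz)
              rw [← this]
              rw [if_pos (h ▸ this)] at hln
              rw [if_pos this] at hlm
              omega
            · have : n (Y e) = 0 := by
                by_contra hc
                exact h.not_ge (hleN _ (Nat.pos_of_ne_zero hc) hyx)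
              omega
          obtain ⟨B, hB, hBc⟩ := ih hny
          obtain ⟨hB', hcard⟩ := hB.insert hse hye hvy
          refine ⟨_, hB', ?_⟩
          have hmz : mass n (· ≤ Y e) = mass n (· ≤ v) := by
            refine mass_congr fun a ha => ⟨fun h => ?_, fun h => h.trans hvy⟩
            refine (hleN a (Nat.pos_of_ne_zero ha) ?_).trans hvz
            rcases hyx with h' | h'
            · exact Or.inl h'
            · exact Or.inr (h.trans_lt h')
          by_cases hz0 : z = 0
          · rw [if_neg (by simp [hz0])] at h1 h3
            have : mass n (· ≤ Y e) = 0 := by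
              refine mass_eq_zero fun a ha => ?_
              by_contra hc
              have := hleN a (Nat.pos_of_ne_zero hc) (hyx.imp_right ha.trans_lt)
              rw [hz0, Fin.le_zero_iff] at this
              exact hc (this ▸ hn0)
            omega
          · rw [if_pos hz0] at h1
            rw [if_pos ⟨hz0, hvz⟩] at h3
            omega

/-- The windows of the released configuration in `[s, e)` are large enough to account for the
balls that have left the carrier in between. -/
theorem exists_isWindow_release (hY : ∀ i, Y i = release (carrier X 0 i) (X i))
    (hse : s ≤ e) : ∃ d B, s ≤ d ∧ d ≤ e ∧ IsWindow Y 0 s d B ∧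
      zeros Y s d + size (carrier X 0 s) + size (carrier X s e) ≤
        B.card + size (carrier X 0 e) := by
  induction e, hse using Nat.le_induction with
  | base => exact ⟨s, ∅, le_rfl, le_rfl, isWindow_empty,
      by simp [carrier_eq_zero, size, zeros_of_le]⟩
  | succ e hse ih =>
    rw [carrier_succ hse, carrier_succ (Nat.zero_le _)]
    have hn0 := carrier_apply_zero (X := X) (s := s) (e := e)
    have hm0 := carrier_apply_zero (X := X) (s := 0) (e := e)
    have h1 := size_load (x := X e) hn0
    have h2 := size_load (x := X e) hm0
    have hy := hY e
    -- D(s,e) grows only where the carrier from 0 releases a ball and the carrier from `s` does not.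
    -- Such a box ends a window that realizes the new value; at other boxes the old window still
    -- suffices, hence `d ≤ e` rather than `d = e`.
    by_cases h : release (carrier X s e) (X e) = 0 ∧ Y e ≠ 0
    · obtain ⟨hz, hye⟩ := h
      obtain ⟨hmy, hyx⟩ := release_mem (hy ▸ hye)
      rw [← hy] at hmy hyx h2
      have hn : ∀ a, a ≤ Y e → carrier X s e a = 0 := by
        intro a ha
        by_contra hc
        have := le_release (Nat.pos_of_ne_zero hc) (hyx.imp_right ha.trans_lt)
        rw [hz, Fin.le_zero_iff] at this
        exact hc (this ▸ hn0)
      obtain ⟨B, hB, hBc⟩ := exists_isWindow_of_carrier_lt hY hse (v := Y e)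
        (by rw [hn _ le_rfl]; exact hmy)
      rw [mass_eq_zero hn] at hBc
      obtain ⟨hB', hcard⟩ := hB.insert hse hye (Fin.zero_le _)
      refine ⟨e + 1, _, by omega, le_rfl, hB', ?_⟩
      rw [zeros_succ hse, if_neg hye]
      rw [if_pos hye] at h2
      rw [if_neg (by simp [hz])] at h1
      omega
    · obtain ⟨d, B, hd1, hd2, hB, hBc⟩ := ih
      refine ⟨d, B, hd1, by omega, hB, ?_⟩
      rw [← hy] at h2
      by_cases hz : release (carrier X s e) (X e) = 0
      · have hye : Y e = 0 := by
          by_contra hc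
          exact h ⟨hz, hc⟩
        rw [if_neg (by simp [hz])] at h1
        rw [if_neg (by simp [hye])] at h2
        omega
      · rw [if_pos hz] at h1
        generalize (if X e ≠ 0 then 1 else 0) = c at h1 h2
        split_ifs at h2 <;> omega

/-- Both carriers pick up the same ball, and the smaller one releases a ball only where the larger
one does. Thus D(s,e) is non-decreasing in `e`. -/
theorem size_add_size_mono (hse : s ≤ e) :
    size (carrier X 0 (e + 1)) + size (carrier X s e) ≤
      size (carrier X 0 e) + size (carrier X s (e + 1)) := by
  rw [carrier_succ hse, carrier_succ (Nat.zero_le _)]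
  have h1 := size_load (x := X e) (carrier_apply_zero (X := X) (s := s) (e := e))
  have h2 := size_load (x := X e) (carrier_apply_zero (X := X) (s := 0) (e := e))
  have h3 := release_mono (x := X e) (carrier_le (X := X) s e)
  by_cases h : release (carrier X 0 e) (X e) = 0
  · rw [h, Fin.le_zero_iff] at h3
    rw [h3] at h1
    rw [h] at h2
    simp only [ne_eq, not_true, if_false] at h1 h2
    omega
  · rw [if_pos h] at h2
    generalize (if X e ≠ 0 then 1 else 0) = c at h1 h2
    split_ifs at h1 <;> omega

end

/-! ### Sums of penalized lengths are preserved in time -/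

section

variable {κ : ℕ} {X : Config κ} {A : Finset ℕ} {m e : ℕ}

theorem penalizedLength_empty (X : Config κ) : penalizedLength ∅ X = 0 := by
  have : gaps ∅ X = ∅ := by ext i; simp [gaps]
  simp [penalizedLength, this]

theorem IsWindow.card_le_penalizedLength {v : Fin (κ + 1)} (hA : IsWindow X v m e A) :
    (A.card : ℤ) ≤ penalizedLength A X + zeros X m e := by
  rw [penalizedLength, if_pos fun a ha b hb => hA.anti a ha b hb]
  have : (gaps A X).ncard ≤ zeros X m e := by
    rw [zeros, ← Set.ncard_coe_finset]
    refine Set.ncard_le_ncard ?_ (Finset.finite_toSet _)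
    rintro i ⟨⟨a, ha, hai⟩, ⟨b, hb, hib⟩, hi⟩
    have h1 := hA.mem a ha
    have h2 := hA.mem b hb
    simp only [Finset.coe_filter, Finset.mem_Ico, Set.mem_ofPred_eq]
    exact ⟨by omega, hi⟩
  omega

/-- Reduction to windows: an empty box in `A` costs as much as it contributes, so only the balls of
`A` are kept, and `m` and `b` are the first and the last of them. -/
theorem penalizedLength_le (A : Finset ℕ) (X : Config κ) : penalizedLength A X ≤ 0 ∨
    ∃ m ∈ A, ∃ b ∈ A, m ≤ b ∧ ∃ A' ⊆ A, b ∈ A' ∧ IsWindow X 0 m (b + 1) A' ∧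
      penalizedLength A X + zeros X m (b + 1) ≤ A'.card := by
  by_cases hanti : ∀ a ∈ A, ∀ b ∈ A, a ≤ b → X b ≤ X a
  · rw [penalizedLength, if_pos hanti]
    set A' := A.filter fun a => X a ≠ 0 with hA'
    have hcard : A.card = A'.card + (A.filter fun a => X a = 0).card := by
      rw [add_comm, hA', Finset.card_filter_add_card_filter_not]
    have hfin : (gaps A X).Finite := by
      refine (Finset.finite_toSet (Finset.range (A.sup id + 1))).subset ?_
      rintro i ⟨-, ⟨b, hb, hib⟩, -⟩
      have := Finset.le_sup (f := id) hb
      simp only [id] at this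
      simp only [Finset.coe_range, Set.mem_Iio]
      omega
    rcases A'.eq_empty_or_nonempty with hne | hne
    · left
      have : (A.filter fun a => X a = 0).card ≤ (gaps A X).ncard := by
        rw [← Set.ncard_coe_finset]
        refine Set.ncard_le_ncard ?_ hfin
        intro i hi
        simp only [Finset.coe_filter, Set.mem_ofPred_eq] at hi
        exact ⟨⟨i, hi.1, le_rfl⟩, ⟨i, hi.1, le_rfl⟩, hi.2⟩
      rw [hne, Finset.card_empty] at hcard
      omega
    · right
      obtain ⟨hm, hmin⟩ := Finset.isLeast_min' A' hne
      obtain ⟨hb, hmax⟩ := Finset.isGreatest_max' A' hne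
      set m := A'.min' hne
      set b := A'.max' hne
      have hm' := Finset.mem_filter.1 (Finset.mem_coe.1 hm)
      have hb' := Finset.mem_filter.1 (Finset.mem_coe.1 hb)
      refine ⟨m, hm'.1, b, hb'.1, hmin hb, A', Finset.filter_subset _ _, hb, ⟨?_, ?_, ?_, ?_⟩, ?_⟩
      · intro a ha
        exact ⟨hmin ha, Nat.lt_succ_of_le (hmax ha)⟩
      · intro a ha; exact (Finset.mem_filter.1 ha).2
      · intro a _; exact Fin.zero_le _
      · intro a ha c hc
        exact hanti a (Finset.mem_filter.1 ha).1 c (Finset.mem_filter.1 hc).1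
      -- By monotonicity the empty boxes of `A` lie behind its last ball, so they are penalized in
      -- addition to those between `m` and `b`.
      · have hdisj : Disjoint (A.filter fun a => X a = 0)
            ((Finset.Ico m (b + 1)).filter fun i => X i = 0) := by
          rw [Finset.disjoint_left]
          intro i hi hi'
          rw [Finset.mem_filter] at hi
          rw [Finset.mem_filter, Finset.mem_Ico] at hi'
          have := hanti i hi.1 b hb'.1 (by omega)
          rw [hi.2, Fin.le_zero_iff] at this
          exact hb'.2 this
        have : (A.filter fun a => X a = 0).card + zeros X m (b + 1) ≤ (gaps A X).ncard := by
          rw [zeros, ← Finset.card_union_of_disjoint hdisj, ← Set.ncard_coe_finset]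
          refine Set.ncard_le_ncard ?_ hfin
          intro i hi
          simp only [Finset.coe_union, Finset.coe_filter, Finset.mem_Ico, Set.mem_union,
            Set.mem_ofPred_eq] at hi
          rcases hi with hi | hi
          · exact ⟨⟨i, hi.1, le_rfl⟩, ⟨i, hi.1, le_rfl⟩, hi.2⟩
          · exact ⟨⟨m, hm'.1, hi.1.1⟩, ⟨b, hb'.1, by omega⟩, hi.2⟩
        omega
  · left
    rw [penalizedLength, if_neg hanti]

/-- `n` is the sum of the penalized lengths of `l` successive sets of boxes in `[0, e)`. -/
def Attains {κ : ℕ} (X : Config κ) : ℕ → ℕ → ℤ → Prop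
  | 0, _, n => n = 0
  | l + 1, e, n => ∃ s ≤ e, ∃ A : Finset ℕ, (∀ a ∈ A, s ≤ a ∧ a < e) ∧
      Attains X l s (n - penalizedLength A X)

theorem Attains.mono {l : ℕ} {n : ℤ} (h : Attains X l m n) (hme : m ≤ e) :
    Attains X l e n := by
  cases l with
  | zero => exact h
  | succ l =>
    obtain ⟨s, hs, A, hA, h⟩ := h
    exact ⟨s, hs.trans hme, A, fun a ha => ⟨(hA a ha).1, (hA a ha).2.trans_le hme⟩, h⟩

theorem Attains.append {l : ℕ} {n : ℤ} (h : Attains X l m n) (hme : m ≤ e)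
    (hA : ∀ a ∈ A, m ≤ a ∧ a < e) : Attains X (l + 1) e (n + penalizedLength A X) :=
  ⟨m, hme, A, hA, by simpa using h⟩

theorem Attains.append_empty {l : ℕ} {n : ℤ} (h : Attains X l e n) : Attains X (l + 1) e n := by
  simpa [penalizedLength_empty] using h.append le_rfl (A := ∅) (by simp)

theorem attains_sum {l : ℕ} (A : Fin l → Finset ℕ) (hA : ∀ i j, i < j → Precedes (A i) (A j))
    (he : ∀ i, ∀ a ∈ A i, a < e) : Attains X l e (∑ i, penalizedLength (A i) X) := by
  induction l generalizing e with
  | zero => simp [Attains]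
  | succ l ih =>
    rw [Fin.sum_univ_castSucc]
    have hA' : ∀ i j : Fin l, i < j → Precedes (A i.castSucc) (A j.castSucc) :=
      fun i j hij => hA _ _ (by simpa using hij)
    rcases (A (Fin.last l)).eq_empty_or_nonempty with h | h
    · refine (ih (fun i => A i.castSucc) hA' (fun i => he _)).append le_rfl ?_
      simp [h]
    · obtain ⟨hm, hmin⟩ := Finset.isLeast_min' _ h
      refine (ih (fun i => A i.castSucc) hA'
        (fun i a ha => hA i.castSucc (Fin.last l) (Fin.castSucc_lt_last i) a ha _ hm)).append
        (he _ _ hm).le ?_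
      exact fun a ha => ⟨hmin ha, he _ a ha⟩

theorem Attains.exists_family {l : ℕ} {n : ℤ} (h : Attains X l e n) :
    ∃ A : Fin l → Finset ℕ, (∀ i j, i < j → Precedes (A i) (A j)) ∧
      (∀ i, ∀ a ∈ A i, a < e) ∧ n = ∑ i, penalizedLength (A i) X := by
  induction l generalizing e n with
  | zero => exact ⟨fun _ => ∅, fun i => i.elim0, fun i => i.elim0, by simpa [Attains] using h⟩
  | succ l ih =>
    obtain ⟨s, hs, B, hB, h⟩ := h
    obtain ⟨A, hA, hAs, hn⟩ := ih h
    refine ⟨Fin.snoc A B, ?_, ?_, ?_⟩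
    · intro i j
      induction i using Fin.lastCases with
      | last => intro h; exact absurd h (Fin.le_last j).not_gt
      | cast i =>
        induction j using Fin.lastCases with
        | last =>
          intro _ a ha b hb
          simp only [Fin.snoc_castSucc, Fin.snoc_last] at ha hb
          exact (hAs i a ha).trans_le (hB b hb).1
        | cast j =>
          intro hij
          simpa only [Fin.snoc_castSucc] using hA i j (by simpa using hij)
    · intro i
      induction i using Fin.lastCases with
      | last => simp only [Fin.snoc_last]; exact fun a ha => (hB a ha).2
      | cast i => simp only [Fin.snoc_castSucc]; exact fun a ha => (hAs i a ha).trans_le hs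
    · simp only [Fin.sum_univ_castSucc, Fin.snoc_castSucc, Fin.snoc_last]
      omega

end

section

variable {κ : ℕ}

theorem release_ne_zero {n : Fin (κ + 1) → ℕ} (hn : n 0 = 0) (hs : size n ≠ 0) :
    release n 0 ≠ 0 := by
  rw [← mass_eq_size (p := fun _ => True) (by simp)] at hs
  obtain ⟨a, -, ha⟩ := exists_of_mass_pos (Nat.pos_of_ne_zero hs)
  intro h
  have := le_release ha (x := 0) (Or.inl rfl)
  rw [h, Fin.le_zero_iff] at this
  exact ha.ne' (this ▸ hn)

/-- The carrier is empty in the end. -/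
theorem exists_size_carrier_eq_zero (X : Config κ) :
    ∃ E, ∀ e, E ≤ e → ∀ s, size (carrier X s e) = 0 := by
  obtain ⟨M, hM⟩ : ∃ M, ∀ x, M ≤ x → X x = 0 := by
    refine ⟨X.support.sup id + 1, fun x hx => ?_⟩
    by_contra h
    have := Finset.le_sup (f := id) (Finsupp.mem_support_iff.2 h)
    simp only [id] at this
    omega
  have key : ∀ i, size (carrier X 0 (M + i)) ≤ size (carrier X 0 M) - i := by
    intro i
    induction i with
    | zero => simp
    | succ i ih =>
      rw [← add_assoc, carrier_succ (Nat.zero_le _), hM _ (by omega)]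
      have hn0 := carrier_apply_zero (X := X) (s := 0) (e := M + i)
      have h1 := size_load (x := 0) hn0
      simp only [ne_eq, not_true, if_false] at h1
      by_cases h : size (carrier X 0 (M + i)) = 0
      · omega
      · rw [if_pos (release_ne_zero hn0 h)] at h1
        omega
  refine ⟨M + size (carrier X 0 M), fun e he s => ?_⟩
  have h1 := key (e - M)
  rw [show M + (e - M) = e by omega] at h1
  have h2 : size (carrier X s e) ≤ size (carrier X 0 e) :=
    Finset.sum_le_sum fun a _ => carrier_le s e a
  omega

theorem size_add_size_le (X : Config κ) {s d e : ℕ} (hsd : s ≤ d) (hde : d ≤ e) :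
    size (carrier X 0 e) + size (carrier X s d) ≤
      size (carrier X 0 d) + size (carrier X s e) := by
  induction e, hde using Nat.le_induction with
  | base => rfl
  | succ e hde ih =>
    have := size_add_size_mono (X := X) (hsd.trans hde)
    omega

variable {X : Config κ}

/-- A further set with last ball `b` has penalized length at most c(d,b+1), where `d` is the
previous cut. Since c(0,d) + c(d,b+1) = D(d,b+1) + c(0,b+1), a window of `step X` takes over the
first summand and the second is passed on. -/
theorem Attains.step_add_size {l e : ℕ} {n : ℤ} (h : Attains X (l + 1) e n) :
    ∃ d ≤ e, ∃ m, Attains (step X) l d m ∧ n ≤ m + size (carrier X 0 d) := by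
  induction l generalizing e n with
  | zero =>
    obtain ⟨s, hs, A, hA, h⟩ := h
    simp only [Attains, sub_eq_zero] at h
    rcases penalizedLength_le A X with h0 | ⟨m, hm, b, hb, hcb, A', -, -, hA', hc⟩
    · exact ⟨0, Nat.zero_le _, 0, rfl, by omega⟩
    · have := hA'.card_le (Nat.zero_le m)
      rw [mass_eq_size fun _ => Fin.zero_le _] at this
      exact ⟨b + 1, (hA b hb).2, 0, rfl, by omega⟩
  | succ l ih =>
    obtain ⟨s, hs, A, hA, h⟩ := h
    obtain ⟨d, hd, m, hm, hn⟩ := ih h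
    rcases penalizedLength_le A X with h0 | ⟨c, hcA, b, hb, hcb, A', -, -, hA', hc⟩
    · exact ⟨d, hd.trans hs, m, hm.append_empty, by omega⟩
    · have hcb : c ≤ b + 1 := by omega
      have hdc := hd.trans (hA c hcA).1
      have h1 := hA'.card_le hdc
      rw [mass_eq_size fun _ => Fin.zero_le _] at h1
      obtain ⟨f, B, hf1, hf2, hB, hBc⟩ := exists_isWindow_release (X := X) (Y := step X)
        (step_apply X) (hdc.trans hcb)
      have h2 := hB.card_le_penalizedLength
      refine ⟨b + 1, (hA b hb).2, _, hm.append (hdc.trans hcb)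
        fun a ha => ⟨(hB.mem a ha).1, (hB.mem a ha).2.trans_le hf2⟩, ?_⟩
      omega

/-- The reverse exchange: a set of `step X` with first ball `c` is worth at most D(c,e), and D(c,e)
+ c(0,e) = c(0,c) + c(c,e). The term c(0,c) goes to the induction hypothesis and c(c,e) is realized
by a window of `X`. -/
theorem Attains.add_size_of_step {l e : ℕ} {n : ℤ} (h : Attains (step X) l e n) :
    ∃ m, Attains X (l + 1) e m ∧ n + size (carrier X 0 e) ≤ m := by
  induction l generalizing e n with
  | zero =>
    obtain ⟨c, A, -, hc, hA, hAc⟩ := exists_isWindow_carrier (X := X) (Nat.zero_le e) 0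
    rw [mass_eq_size fun _ => Fin.zero_le _] at hAc
    have h1 := hA.card_le_penalizedLength
    refine ⟨_, Attains.append (m := 0) h (Nat.zero_le e)
      fun a ha => ⟨Nat.zero_le _, (hA.mem a ha).2⟩, ?_⟩
    omega
  | succ l ih =>
    obtain ⟨s, hs, B, hB, h⟩ := h
    rcases penalizedLength_le B (step X) with h0 | ⟨c, hcB, b, hb, hcb, B', -, -, hB', hc⟩
    · obtain ⟨m, hm, hn⟩ := ih (h.mono hs)
      exact ⟨m, hm.append_empty, by omega⟩
    · have hcb : c ≤ b + 1 := by omega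
      have hbe : b + 1 ≤ e := (hB b hb).2
      obtain ⟨m, hm, hn⟩ := ih (h.mono (hB c hcB).1)
      have h1 := card_add_size_le (X := X) (Y := step X) (step_apply X) hcb hB'
      have h2 := size_add_size_le X hcb hbe
      obtain ⟨f, A, hf1, hf2, hA, hAc⟩ := exists_isWindow_carrier (X := X) (hcb.trans hbe) 0
      rw [mass_eq_size fun _ => Fin.zero_le _] at hAc
      have h3 := hA.card_le_penalizedLength
      refine ⟨_, hm.append (hcb.trans hbe)
        fun a ha => ⟨hf1.trans (hA.mem a ha).1, (hA.mem a ha).2⟩, ?_⟩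
      omega

/-- For large e the carriers are empty and D(d,e) = c(0,d). Hence the load left over in
`Attains.step_add_size` becomes one more set of `step X`, which restores the number of sets. -/
theorem Attains.exists_step {l e : ℕ} {n : ℤ} (h : Attains X l e n) :
    ∃ d m, Attains (step X) l d m ∧ n ≤ m := by
  cases l with
  | zero => exact ⟨0, n, h, le_rfl⟩
  | succ l =>
    obtain ⟨d, -, m, hm, hn⟩ := h.step_add_size
    obtain ⟨E, hE⟩ := exists_size_carrier_eq_zero X
    obtain ⟨f, B, hf1, hf2, hB, hBc⟩ := exists_isWindow_release (X := X) (Y := step X)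
        (step_apply X) (Nat.le_add_right d E)
    rw [hE (d + E) (by omega), hE (d + E) (by omega)] at hBc
    have h2 := hB.card_le_penalizedLength
    exact ⟨f, _, hm.append hf1 hB.mem, by omega⟩

/-- The last set, with first ball `c`, is worth at most D(c,e) = c(0,c) for large e. This is the
bonus that `Attains.add_size_of_step` grants to the other sets. -/
theorem Attains.exists_of_step {l e : ℕ} {n : ℤ} (h : Attains (step X) l e n) :
    ∃ d m, Attains X l d m ∧ n ≤ m := by
  cases l with
  | zero => exact ⟨0, n, h, le_rfl⟩
  | succ l =>
    obtain ⟨s, hs, B, hB, h⟩ := h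
    rcases penalizedLength_le B (step X) with h0 | ⟨c, hcB, b, hb, hcb, B', -, -, hB', hc⟩
    · obtain ⟨m, hm, hn⟩ := h.add_size_of_step
      exact ⟨s, m, hm, by omega⟩
    · have hcb : c ≤ b + 1 := by omega
      obtain ⟨m, hm, hn⟩ := (h.mono (hB c hcB).1).add_size_of_step
      obtain ⟨E, hE⟩ := exists_size_carrier_eq_zero X
      have h1 := card_add_size_le (X := X) (Y := step X) (step_apply X) hcb hB'
      have h2 := size_add_size_le X hcb (Nat.le_add_right (b + 1) E)
      rw [hE (b + 1 + E) (by omega), hE (b + 1 + E) (by omega)] at h2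
      exact ⟨c, m, hm, by omega⟩

/-- `V` is the maximal sum of the penalized lengths of `l` successive sets of boxes. -/
def IsMaxSum {κ : ℕ} (X : Config κ) (l : ℕ) (V : ℤ) : Prop :=
  (∃ e, Attains X l e V) ∧ ∀ e n, Attains X l e n → n ≤ V

theorem isMaxSum_step_iff {l : ℕ} {V : ℤ} : IsMaxSum (step X) l V ↔ IsMaxSum X l V := by
  constructor
  · rintro ⟨⟨e, h⟩, hmax⟩
    obtain ⟨d, m, hm, hVm⟩ := h.exists_of_step
    have key : ∀ d' n, Attains X l d' n → n ≤ V := by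
      intro d' n hn
      obtain ⟨d'', m', hm', hnm⟩ := hn.exists_step
      exact hnm.trans (hmax _ _ hm')
    exact ⟨⟨d, le_antisymm (key d m hm) hVm ▸ hm⟩, key⟩
  · rintro ⟨⟨e, h⟩, hmax⟩
    obtain ⟨d, m, hm, hVm⟩ := h.exists_step
    have key : ∀ d' n, Attains (step X) l d' n → n ≤ V := by
      intro d' n hn
      obtain ⟨d'', m', hm', hnm⟩ := hn.exists_of_step
      exact hnm.trans (hmax _ _ hm')
    exact ⟨⟨d, le_antisymm (key d m hm) hVm ▸ hm⟩, key⟩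

theorem trajectory_succ (X : Config κ) (t : ℕ) :
    trajectory X (t + 1) = step (trajectory X t) := Function.iterate_succ_apply' _ _ _

theorem isMaxSum_trajectory_iff {l : ℕ} {V : ℤ} (t : ℕ) :
    IsMaxSum (trajectory X t) l V ↔ IsMaxSum X l V := by
  induction t with
  | zero => rfl
  | succ t ih => rw [trajectory_succ, isMaxSum_step_iff, ih]

theorem IsMaxSum.isGreatest {l : ℕ} {V : ℤ} (h : IsMaxSum X l V) :
    IsGreatest {n : ℤ | ∃ A : Fin l → Finset ℕ, (∀ i j, i < j → Precedes (A i) (A j)) ∧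
      n = ∑ i, penalizedLength (A i) X} V := by
  refine ⟨?_, ?_⟩
  · obtain ⟨e, he⟩ := h.1
    obtain ⟨A, hA, -, hV⟩ := he.exists_family
    exact ⟨A, hA, hV⟩
  · rintro n ⟨A, hA, rfl⟩
    refine h.2 (Finset.univ.sup (fun i => (A i).sup id) + 1) _ (attains_sum A hA fun i a ha => ?_)
    have h1 := Finset.le_sup (f := id) ha
    have h2 := Finset.le_sup (f := fun i => (A i).sup id) (Finset.mem_univ i)
    simp only [id] at h1 h2
    omega

end

/-! ### Duality of ascents and penalized lengths -/

/-- The balls in `A` that are larger than their predecessor in `A`, if there is one. -/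
def rises {κ : ℕ} (A : Set ℕ) (X : Config κ) : Set ℕ :=
  {b | b ∈ A ∧ X b ≠ 0 ∧ ∀ a ∈ A, a < b → (∀ c ∈ A, c < b → c ≤ a) → X a < X b}

section

variable {κ : ℕ} {X : Config κ}

theorem exists_predecessor {A : Set ℕ} {b c : ℕ} (hc : c ∈ A) (hcb : c < b) :
    ∃ a ∈ A, a < b ∧ c ≤ a ∧ ∀ d ∈ A, d < b → d ≤ a := by
  obtain ⟨a, ⟨ha, hab⟩, hmax⟩ := Set.exists_max_image {d | d ∈ A ∧ d < b} id
    ((Set.finite_Iio b).subset fun d hd => hd.2) ⟨c, hc, hcb⟩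
  exact ⟨a, ha, hab, hmax c ⟨hc, hcb⟩, fun d hd hdb => hmax d ⟨hd, hdb⟩⟩

theorem rises_subset (A : Set ℕ) : rises A X ⊆ X.support := fun b hb => by
  simpa using hb.2.1

/-- The leading ascent needs no special treatment for `rises`: a ball without predecessor satisfies
the condition vacuously. -/
theorem NA_eq_ncard_rises (A : Set ℕ) (X : Config κ) : NA A X = (rises A X).ncard := by
  unfold NA
  split_ifs with h
  · obtain ⟨a, ha, hmin, hpos⟩ := h
    have h1 : a ∉ ascents A X := by
      rintro ⟨-, c, hc, hca, -⟩
      have := hmin c hc; omega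
    have h2 : rises A X = insert a (ascents A X) := by
      ext b
      constructor
      · rintro ⟨hb, hb0, hasc⟩
        rcases (hmin b hb).eq_or_lt with h | h
        · exact Or.inl h.symm
        · obtain ⟨c, hc, hcb, -, hcmax⟩ := exists_predecessor ha h
          exact Or.inr ⟨hb, c, hc, hcb, hcmax, hasc c hc hcb hcmax⟩
      · rintro (rfl | ⟨hb, c, hc, hcb, hcmax, hlt⟩)
        · refine ⟨ha, hpos.ne', fun c hc hcb => ?_⟩
          have := hmin c hc; omega
        · refine ⟨hb, (bot_le.trans_lt hlt).ne', fun d hd hdb hdmax => ?_⟩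
          rwa [le_antisymm (hcmax d hd hdb) (hdmax c hc hcb)]
    rw [h2, Set.ncard_insert_of_notMem h1 (ascents_finite A X), add_comm]
  · rw [zero_add]
    congr 1
    ext b
    constructor
    · rintro ⟨hb, c, hc, hcb, hcmax, hlt⟩
      refine ⟨hb, (bot_le.trans_lt hlt).ne', fun d hd hdb hdmax => ?_⟩
      rwa [le_antisymm (hcmax d hd hdb) (hdmax c hc hcb)]
    · rintro ⟨hb, hb0, hasc⟩
      by_cases hmin : ∀ c ∈ A, b ≤ c
      · exact (h ⟨b, hb, hmin, Fin.pos_of_ne_zero hb0⟩).elim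
      · push Not at hmin
        obtain ⟨d, hd, hdb⟩ := hmin
        obtain ⟨c, hc, hcb, -, hcmax⟩ := exists_predecessor hd hdb
        exact ⟨hb, c, hc, hcb, hcmax, hasc c hc hcb hcmax⟩

/-- Between two balls of non-increasing colors there is a box that is not a rise. -/
theorem exists_notMem_rises {A : Set ℕ} {b c : ℕ} (hc : c ∈ A) (hb : b ∈ A) (hcb : c < b)
    (hX : X b ≤ X c) : ∃ d ∈ A, c < d ∧ d ≤ b ∧ d ∉ rises A X := by
  by_contra! h
  have key : ∀ d, d ∈ A → c < d → d ≤ b → X c < X d := by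
    intro d
    induction d using Nat.strong_induction_on with
    | _ d ih =>
      intro hd hcd hdb
      obtain ⟨a, ha, had, hca, hmax⟩ := exists_predecessor hc hcd
      have h1 := (h d hd hcd hdb).2.2 a ha had hmax
      rcases hca.eq_or_lt with rfl | hca
      · exact h1
      · exact (ih a had ha hca (by omega)).trans h1
  exact (key b hb hcb le_rfl).not_ge hX

open Classical in
-- Colors do not increase from one element of `W ∩ A` to the next, so after each element but the
-- last there is a non-rise of `A` up to the next one. These non-rises lie in disjoint intervals.
theorem card_filter_le_one_add {v : Fin (κ + 1)} {m e : ℕ} {W : Finset ℕ}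
    (hW : IsWindow X v m e W) (A : Set ℕ) :
    (W.filter (· ∈ A)).card ≤
      1 + ((Finset.Ico m e).filter fun c => c ∈ A ∧ c ∉ rises A X).card := by
  rcases (W.filter (· ∈ A)).eq_empty_or_nonempty with h | h
  · simp [h]
  obtain ⟨hm, hmin⟩ := Finset.isLeast_min' _ h
  set a := (W.filter (· ∈ A)).min' h
  have hex : ∀ b ∈ (W.filter (· ∈ A)).erase a, ∃ d, d ∈ A ∧ d ∉ rises A X ∧ d ≤ b ∧
      ∀ c ∈ W.filter (· ∈ A), c < b → c < d := by
    intro b hb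
    rw [Finset.mem_erase] at hb
    have hab : a < b := lt_of_le_of_ne (hmin hb.2) (Ne.symm hb.1)
    obtain ⟨c, hc, hcb, hac, hmax⟩ := exists_predecessor
      (A := {c | c ∈ W.filter (· ∈ A)}) hm hab
    have hc' := Finset.mem_filter.1 hc
    have hb' := Finset.mem_filter.1 hb.2
    obtain ⟨d, hd, hcd, hdb, hdr⟩ := exists_notMem_rises hc'.2 hb'.2 hcb
      (hW.anti c hc'.1 b hb'.1 hcb.le)
    exact ⟨d, hd, hdr, hdb, fun c' hc' hcb' => (hmax c' hc' hcb').trans_lt hcd⟩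
  choose! f hf using hex
  have hcard : ((W.filter (· ∈ A)).erase a).card ≤
      ((Finset.Ico m e).filter fun c => c ∈ A ∧ c ∉ rises A X).card := by
    refine Finset.card_le_card_of_injOn f ?_ ?_
    · intro b hb
      obtain ⟨h1, h2, h3, h4⟩ := hf b hb
      rw [Finset.mem_coe, Finset.mem_erase] at hb
      have h5 := h4 a hm (lt_of_le_of_ne (hmin hb.2) (Ne.symm hb.1))
      have h6 := hW.mem a (Finset.mem_filter.1 hm).1
      have h7 := hW.mem b (Finset.mem_filter.1 hb.2).1
      rw [Finset.mem_coe, Finset.mem_filter, Finset.mem_Ico]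
      exact ⟨by omega, h1, h2⟩
    · intro b hb c hc hbc
      obtain ⟨-, -, h3, h4⟩ := hf b hb
      obtain ⟨-, -, h3', h4'⟩ := hf c hc
      rcases lt_trichotomy b c with h | h | h
      · have := h4' b (Finset.mem_of_mem_erase hb) h; omega
      · exact h
      · have := h4 c (Finset.mem_of_mem_erase hc) h; omega
  rw [Finset.card_erase_of_mem hm] at hcard
  omega

open Classical in
theorem sum_NA_eq_card {k : ℕ} {A : Fin k → Set ℕ} (hA : ∀ i j, i ≠ j → Disjoint (A i) (A j)) :
    ∑ i, NA (A i) X = (X.support.filter fun b => ∃ i, b ∈ rises (A i) X).card := by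
  have h1 : X.support.filter (fun b => ∃ i, b ∈ rises (A i) X) =
      Finset.univ.biUnion fun i => X.support.filter (· ∈ rises (A i) X) := by
    ext b; simp
  rw [h1, Finset.card_biUnion]
  · refine Finset.sum_congr rfl fun i _ => ?_
    rw [NA_eq_ncard_rises, ← Set.ncard_coe_finset]
    congr 1
    ext b
    simpa using fun h => by simpa using rises_subset (A i) h
  · intro i _ j _ hij
    rw [Function.onFun, Finset.disjoint_left]
    intro b hb hb'
    exact Set.disjoint_left.1 (hA i j hij) (Finset.mem_filter.1 hb).2.1
      (Finset.mem_filter.1 hb').2.1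

open Classical in
-- Summing over the classes costs one per class; each non-rise so counted is an empty box or a ball
-- that is a rise of no class.
theorem IsWindow.card_le_rises {k : ℕ} {A : Fin k → Set ℕ}
    (hA : ∀ i j, i ≠ j → Disjoint (A i) (A j)) (hAu : (⋃ i, A i) = Set.univ)
    {v : Fin (κ + 1)} {m e : ℕ} {W : Finset ℕ} (hW : IsWindow X v m e W) :
    W.card ≤ k + zeros X m e + ((Finset.Ico m e).filter
      fun b => X b ≠ 0 ∧ ∀ i, b ∉ rises (A i) X).card := by
  have h1 : W = Finset.univ.biUnion fun i => W.filter (· ∈ A i) := by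
    ext b
    have : b ∈ ⋃ i, A i := hAu ▸ Set.mem_univ b
    simp only [Finset.mem_biUnion, Finset.mem_univ, Finset.mem_filter, true_and,
      exists_and_left, Set.mem_iUnion] at this ⊢
    exact ⟨fun h => ⟨h, this⟩, fun h => h.1⟩
  have h2 : W.card ≤ ∑ i, (1 + ((Finset.Ico m e).filter
      fun c => c ∈ A i ∧ c ∉ rises (A i) X).card) := by
    conv_lhs => rw [h1]
    exact Finset.card_biUnion_le.trans
      (Finset.sum_le_sum fun i _ => card_filter_le_one_add hW (A i))
  rw [Finset.sum_add_distrib, ← Finset.card_biUnion] at h2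
  · have h3 : (Finset.univ.biUnion fun i => (Finset.Ico m e).filter
        fun c => c ∈ A i ∧ c ∉ rises (A i) X) ⊆ ((Finset.Ico m e).filter fun b => X b = 0) ∪
        ((Finset.Ico m e).filter fun b => X b ≠ 0 ∧ ∀ i, b ∉ rises (A i) X) := by
      intro b hb
      simp only [Finset.mem_biUnion, Finset.mem_univ, Finset.mem_filter, true_and] at hb
      obtain ⟨i, hb, hbi, hbr⟩ := hb
      rw [Finset.mem_union, Finset.mem_filter, Finset.mem_filter]
      by_cases h0 : X b = 0
      · exact Or.inl ⟨hb, h0⟩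
      · refine Or.inr ⟨hb, h0, fun j hj => ?_⟩
        by_cases hij : i = j
        · exact hbr (hij ▸ hj)
        · exact Set.disjoint_left.1 (hA i j hij) hbi hj.1
    have h4 := (Finset.card_le_card h3).trans (Finset.card_union_le _ _)
    simp only [Finset.sum_const, Finset.card_univ, Fintype.card_fin, smul_eq_mul, mul_one] at h2
    unfold zeros
    omega
  · intro i _ j _ hij
    rw [Function.onFun, Finset.disjoint_left]
    intro b hb hb'
    exact Set.disjoint_left.1 (hA i j hij) (Finset.mem_filter.1 hb).2.1
      (Finset.mem_filter.1 hb').2.1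

/-- Weak duality. -/
theorem sum_NA_add_le {k : ℕ} {A : Fin k → Set ℕ} (hA : ∀ i j, i ≠ j → Disjoint (A i) (A j))
    (hAu : (⋃ i, A i) = Set.univ) {l e : ℕ} {n : ℤ} (h : Attains X l e n) :
    ((∑ i, NA (A i) X : ℕ) : ℤ) + n ≤ X.support.card + k * l := by
  classical
  -- The sets lie in disjoint intervals, so a ball that is not a rise is charged at most once.
  have key : ∀ l e n, Attains X l e n → n ≤ k * l + ((Finset.Ico 0 e).filter
      fun b => X b ≠ 0 ∧ ∀ i, b ∉ rises (A i) X).card := by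
    intro l
    induction l with
    | zero =>
      intro e n h
      have h : n = 0 := h
      rw [h]; positivity
    | succ l ih =>
      rintro e n ⟨s, hs, W, hW, h⟩
      have h1 := ih s _ h
      have h2 : ((Finset.Ico 0 e).filter fun b => X b ≠ 0 ∧ ∀ i, b ∉ rises (A i) X).card =
          ((Finset.Ico 0 s).filter fun b => X b ≠ 0 ∧ ∀ i, b ∉ rises (A i) X).card +
          ((Finset.Ico s e).filter fun b => X b ≠ 0 ∧ ∀ i, b ∉ rises (A i) X).card := by
        rw [← Finset.card_union_of_disjoint, ← Finset.filter_union,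
          Finset.Ico_union_Ico_eq_Ico (Nat.zero_le s) hs]
        exact Finset.disjoint_filter_filter (Finset.Ico_disjoint_Ico_consecutive 0 s e)
      have h3 : penalizedLength W X ≤ k + ((Finset.Ico s e).filter
          fun b => X b ≠ 0 ∧ ∀ i, b ∉ rises (A i) X).card := by
        rcases penalizedLength_le W X with h0 | ⟨m, hm, b, hb, -, W', -, -, hW', hc⟩
        · omega
        · have h4 := hW'.card_le_rises hA hAu
          have h5 : ((Finset.Ico m (b + 1)).filter
              fun b => X b ≠ 0 ∧ ∀ i, b ∉ rises (A i) X).card ≤ ((Finset.Ico s e).filter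
              fun b => X b ≠ 0 ∧ ∀ i, b ∉ rises (A i) X).card :=
            Finset.card_le_card (Finset.filter_subset_filter _
              (Finset.Ico_subset_Ico (hW m hm).1 (hW b hb).2))
          omega
      rw [h2]
      push_cast
      rw [mul_add, mul_one]
      omega
  have h1 := key l e n h
  have h2 : (X.support.filter fun b => ∃ i, b ∈ rises (A i) X).card + ((Finset.Ico 0 e).filter
      fun b => X b ≠ 0 ∧ ∀ i, b ∉ rises (A i) X).card ≤ X.support.card := by
    rw [← Finset.card_union_of_disjoint]
    · refine Finset.card_le_card fun b hb => ?_
      rcases Finset.mem_union.1 hb with hb | hb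
      · exact (Finset.mem_filter.1 hb).1
      · simpa using (Finset.mem_filter.1 hb).2.1
    · rw [Finset.disjoint_left]
      intro b hb hb'
      obtain ⟨i, hi⟩ := (Finset.mem_filter.1 hb).2
      exact (Finset.mem_filter.1 hb').2.2 i hi
  rw [sum_NA_eq_card hA]
  omega

end

/-! ### The greedy partition -/

section

variable {κ k : ℕ} [NeZero k]

/-- The last contents of the classes act like a carrier with `k` places, 0 being a vacancy: the
largest smaller content is replaced, or the largest of all if none is smaller. -/
theorem exists_greedy (c : Fin k → Fin (κ + 1)) (x : Fin (κ + 1)) :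
    ∃ i, (c i < x ∧ ∀ j, c j < x → c j ≤ c i) ∨ ((∀ j, x ≤ c j) ∧ ∀ j, c j ≤ c i) := by
  by_cases h : ∃ i, c i < x
  · obtain ⟨i, hi, hmax⟩ := Set.exists_max_image {i | c i < x} c (Set.toFinite _) h
    exact ⟨i, Or.inl ⟨hi, hmax⟩⟩
  · push Not at h
    obtain ⟨i, hi⟩ := Finite.exists_max c
    exact ⟨i, Or.inr ⟨h, hi⟩⟩

/-- The class to which the greedy partition adds a box with content `x`, if `c` are the contents
of the boxes last added to the classes. -/
noncomputable def greedy (c : Fin k → Fin (κ + 1)) (x : Fin (κ + 1)) : Fin k :=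
  (exists_greedy c x).choose

/-- The contents of the boxes in front of box `e` last added to the classes of the greedy
partition. -/
noncomputable def lasts (k : ℕ) [NeZero k] (X : ℕ → Fin (κ + 1)) : ℕ → Fin k → Fin (κ + 1)
  | 0 => 0
  | e + 1 => Function.update (lasts k X e) (greedy (lasts k X e) (X e)) (X e)

/-- The class of box `e` in the greedy partition. -/
noncomputable def greedyClass (k : ℕ) [NeZero k] (X : ℕ → Fin (κ + 1)) (e : ℕ) : Fin k :=
  greedy (lasts k X e) (X e)

/-- The ball in box `e` is not a rise of the greedy partition. -/
def IsOverflow (k : ℕ) [NeZero k] (X : ℕ → Fin (κ + 1)) (e : ℕ) : Prop :=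
  X e ≠ 0 ∧ X e ≤ lasts k X e (greedyClass k X e)

open Classical in
/-- The number of balls in `[m, e)` which are not rises of the greedy partition. -/
noncomputable def overflows (k : ℕ) [NeZero k] (X : ℕ → Fin (κ + 1)) (m e : ℕ) : ℕ :=
  ((Finset.Ico m e).filter (IsOverflow k X)).card

variable {X : ℕ → Fin (κ + 1)} {m e : ℕ}

theorem lasts_succ (e : ℕ) : lasts k X (e + 1) =
    Function.update (lasts k X e) (greedyClass k X e) (X e) := rfl

theorem greedyClass_spec (e : ℕ) :
    (lasts k X e (greedyClass k X e) < X e ∧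
      ∀ j, lasts k X e j < X e → lasts k X e j ≤ lasts k X e (greedyClass k X e)) ∨
    ((∀ j, X e ≤ lasts k X e j) ∧ ∀ j, lasts k X e j ≤ lasts k X e (greedyClass k X e)) :=
  (exists_greedy (lasts k X e) (X e)).choose_spec

open Classical in
theorem overflows_succ (h : m ≤ e) : overflows k X m (e + 1) =
    overflows k X m e + if IsOverflow k X e then 1 else 0 := by
  unfold overflows
  rw [← Finset.insert_Ico_right_eq_Ico_add_one h, Finset.filter_insert]
  split_ifs with h1
  · rw [Finset.card_insert_of_notMem (by simp)]
  · rfl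

theorem overflows_of_le (h : e ≤ m) : overflows k X m e = 0 := by
  simp [overflows, Finset.Ico_eq_empty_of_le h]

theorem overflows_add (h : m ≤ e) :
    overflows k X 0 m + overflows k X m e = overflows k X 0 e := by
  induction e, h using Nat.le_induction with
  | base => simp [overflows_of_le]
  | succ e h ih => rw [overflows_succ h, overflows_succ (Nat.zero_le e)]; omega

theorem card_lasts_succ (v : Fin (κ + 1)) :
    (Finset.univ.filter fun i => v ≤ lasts k X (e + 1) i).card +
      (if v ≤ lasts k X e (greedyClass k X e) then 1 else 0) =
    (Finset.univ.filter fun i => v ≤ lasts k X e i).card + if v ≤ X e then 1 else 0 := by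
  have h1 : ∀ c : Fin k → Fin (κ + 1), (Finset.univ.filter fun i => v ≤ c i).card =
      ((Finset.univ.erase (greedyClass k X e)).filter fun i => v ≤ c i).card +
        if v ≤ c (greedyClass k X e) then 1 else 0 := by
    intro c
    conv_lhs => rw [← Finset.insert_erase (Finset.mem_univ (greedyClass k X e))]
    rw [Finset.filter_insert]
    split_ifs
    · rw [Finset.card_insert_of_notMem (by simp)]
    · simp
  have h2 : lasts k X (e + 1) (greedyClass k X e) = X e := Function.update_self _ _ _
  have h3 : ((Finset.univ.erase (greedyClass k X e)).filter fun i => v ≤ lasts k X (e + 1) i) =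
      (Finset.univ.erase (greedyClass k X e)).filter fun i => v ≤ lasts k X e i := by
    refine Finset.filter_congr fun i hi => ?_
    rw [lasts_succ, Function.update_of_ne (Finset.ne_of_mem_erase hi)]
  rw [h1 (lasts k X (e + 1)), h1 (lasts k X e), h2, h3]
  omega

/-- Large last contents of the greedy partition come from a window. -/
theorem exists_isWindow_lasts {v : Fin (κ + 1)} (hv : v ≠ 0) : ∃ m A, m ≤ e ∧
    IsWindow X v m e A ∧ (Finset.univ.filter fun i => v ≤ lasts k X e i).card +
      zeros X m e + overflows k X m e ≤ A.card := by
  classical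
  induction e generalizing v with
  | zero =>
    refine ⟨0, ∅, le_rfl, isWindow_empty, ?_⟩
    simp [zeros_of_le, overflows_of_le, lasts, hv]
  | succ e ih =>
    have hQ := card_lasts_succ (k := k) (X := X) (e := e) v
    rcases greedyClass_spec (k := k) (X := X) e with ⟨hlt, hmax⟩ | ⟨hle, hmax⟩
    · have hov : ¬ IsOverflow k X e := fun h => hlt.not_ge h.2
      have hx : X e ≠ 0 := (bot_le.trans_lt hlt).ne'
      by_cases h : v ≤ X e ∧ ¬ v ≤ lasts k X e (greedyClass k X e)
      · obtain ⟨m, A, hm, hA, hc⟩ := ih hx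
        obtain ⟨hA', hcard⟩ := hA.insert hm hx h.1
        refine ⟨m, _, by omega, hA', ?_⟩
        rw [zeros_succ hm, overflows_succ hm, if_neg hx, if_neg hov]
        rw [if_pos h.1, if_neg h.2] at hQ
        -- No last content lies in the range from `v` to below `X e`, because the largest one below
        -- `X e` is already below `v`.
        have : (Finset.univ.filter fun i => v ≤ lasts k X e i) =
            Finset.univ.filter fun i => X e ≤ lasts k X e i := by
          refine Finset.filter_congr fun i _ => ⟨fun hi => ?_, h.1.trans⟩
          by_contra! hc
          exact h.2 (hi.trans (hmax i hc))
        rw [this] at hQ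
        omega
      · obtain ⟨m, A, hm, hA, hc⟩ := ih hv
        refine ⟨m, A, by omega, hA.mono le_rfl le_rfl (Nat.le_succ e), ?_⟩
        rw [zeros_succ hm, overflows_succ hm, if_neg hx, if_neg hov]
        by_cases h1 : v ≤ lasts k X e (greedyClass k X e)
        · rw [if_pos h1, if_pos (h1.trans hlt.le)] at hQ
          omega
        · rw [if_neg h1, if_neg fun h2 => h ⟨h2, h1⟩] at hQ
          omega
    · by_cases hvx : v ≤ X e
      · have hx : X e ≠ 0 := fun h => hv (Fin.le_zero_iff.1 (h ▸ hvx))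
        obtain ⟨m, A, hm, hA, hc⟩ := ih hx
        obtain ⟨hA', hcard⟩ := hA.insert hm hx hvx
        refine ⟨m, _, by omega, hA', ?_⟩
        rw [zeros_succ hm, overflows_succ hm, if_neg hx]
        rw [if_pos hvx, if_pos (hvx.trans (hle _))] at hQ
        have h1 : (Finset.univ.filter fun i => v ≤ lasts k X e i) =
            Finset.univ.filter fun i => X e ≤ lasts k X e i :=
          Finset.filter_congr fun i _ => by simp [hle i, hvx.trans (hle i)]
        rw [h1] at hQ
        split_ifs <;> omega
      · rw [if_neg hvx] at hQ
        by_cases h1 : v ≤ lasts k X e (greedyClass k X e)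
        · rw [if_pos h1] at hQ
          obtain ⟨m, A, hm, hA, hc⟩ := ih hv
          refine ⟨m, A, by omega, hA.mono le_rfl le_rfl (Nat.le_succ e), ?_⟩
          rw [zeros_succ hm, overflows_succ hm]
          by_cases h0 : X e = 0
          · rw [if_pos h0, if_neg (fun h : IsOverflow k X e => h.1 h0)]
            omega
          · rw [if_neg h0]
            split_ifs <;> omega
        -- All last contents are below `v`, so the window is restarted empty.
        · refine ⟨e + 1, ∅, le_rfl, isWindow_empty, ?_⟩
          rw [if_neg h1] at hQ
          have : (Finset.univ.filter fun i => v ≤ lasts k X e i) = ∅ :=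
            Finset.filter_eq_empty_iff.2 fun i _ h => h1 (h.trans (hmax i))
          rw [this, Finset.card_empty] at hQ
          rw [zeros_of_le le_rfl, overflows_of_le le_rfl, Finset.card_empty]
          omega

/-- At the last overflow, all `k` last contents are at least the color met. The window behind them
is therefore worth `k` plus the number of overflows since its left end `m`, and the argument is
repeated in front of `m`. -/
theorem exists_attains_overflows (X : Config κ) (e : ℕ) :
    ∃ l n, Attains X l e n ∧ (k : ℤ) * l + overflows k X 0 e ≤ n := by
  classical
  induction e using Nat.strong_induction_on with
  | _ e ih =>
    cases e with
    | zero => exact ⟨0, 0, rfl, by simp [overflows_of_le]⟩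
    | succ e =>
      by_cases h : IsOverflow k X e
      · obtain ⟨m, A, hm, hA, hc⟩ := exists_isWindow_lasts (k := k) (X := X) (e := e + 1) h.1
        have h1 := card_lasts_succ (k := k) (X := X) (e := e) (X e)
        have h2 : ∀ j, X e ≤ lasts k X e j := by
          rcases greedyClass_spec (k := k) (X := X) e with h' | h'
          · exact (h'.1.not_ge h.2).elim
          · exact h'.1
        rw [if_pos (h2 _), if_pos le_rfl,
          Finset.filter_true_of_mem (s := Finset.univ) (p := fun i => X e ≤ lasts k X e i)
            fun j _ => h2 j, Finset.card_univ, Fintype.card_fin] at h1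
        have hk : 0 < k := Nat.pos_of_ne_zero (NeZero.ne k)
        -- The window has at least `k > 0` elements, so the recursion makes progress.
        have hme : m < e + 1 := by
          by_contra h'
          rw [hA.eq_empty (by omega), Finset.card_empty] at hc
          omega
        obtain ⟨l, n, hn, hln⟩ := ih m hme
        refine ⟨l + 1, _, hn.append hm hA.mem, ?_⟩
        have h3 := hA.card_le_penalizedLength
        have h4 := overflows_add (k := k) (X := X) hm
        push_cast
        rw [mul_add, mul_one]
        omega
      · obtain ⟨l, n, hn, hln⟩ := ih e (Nat.lt_succ_self e)
        refine ⟨l, n, hn.mono (Nat.le_succ e), ?_⟩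
        rw [overflows_succ (Nat.zero_le e), if_neg h]
        simpa using hln

theorem lasts_eq (e : ℕ) (i : Fin k) :
    (∀ a, greedyClass k X a = i → a < e → (∀ c, greedyClass k X c = i → c < e → c ≤ a) →
      lasts k X e i = X a) ∧
    ((∀ c, greedyClass k X c = i → ¬ c < e) → lasts k X e i = 0) := by
  induction e with
  | zero => exact ⟨fun a _ h => absurd h (Nat.not_lt_zero a), fun _ => rfl⟩
  | succ e ih =>
    rw [lasts_succ]
    by_cases h : greedyClass k X e = i
    · have h1 : Function.update (lasts k X e) (greedyClass k X e) (X e) i = X e := by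
        rw [← h]; exact Function.update_self _ _ _
      rw [h1]
      refine ⟨fun a ha hae hmax => ?_, fun hc => (hc e h (Nat.lt_succ_self e)).elim⟩
      have := hmax e h (Nat.lt_succ_self e)
      rw [show a = e by omega]
    · rw [Function.update_of_ne (Ne.symm h)]
      refine ⟨fun a ha hae hmax => ih.1 a ha ?_ fun c hc hce => hmax c hc (by omega),
        fun hc => ih.2 fun c hci hce => hc c hci (by omega)⟩
      have : a ≠ e := fun h' => h (h' ▸ ha)
      omega

theorem mem_rises_greedyClass (X : Config κ) (e : ℕ) (i : Fin k) :
    e ∈ rises {c | greedyClass k X c = i} X ↔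
      greedyClass k X e = i ∧ X e ≠ 0 ∧ ¬ IsOverflow k X e := by
  obtain ⟨h1, h2⟩ := lasts_eq (X := X) e i
  constructor
  · rintro ⟨he, h0, hr⟩
    have he : greedyClass k X e = i := he
    refine ⟨he, h0, fun hov => ?_⟩
    have hov := hov.2
    rw [he] at hov
    by_cases h : ∃ c, greedyClass k X c = i ∧ c < e
    · obtain ⟨c, hc, hce⟩ := h
      obtain ⟨a, ha, hae, -, hmax⟩ :=
        exists_predecessor (A := {c | greedyClass k X c = i}) hc hce
      rw [h1 a ha hae hmax] at hov
      exact (hr a ha hae hmax).not_ge hov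
    · push Not at h
      rw [h2 fun c hc => (h c hc).not_gt] at hov
      exact h0 (Fin.le_zero_iff.1 hov)
  · rintro ⟨he, h0, hov⟩
    refine ⟨he, h0, fun a ha hae hmax => ?_⟩
    rw [← h1 a ha hae hmax]
    by_contra! hc
    exact hov ⟨h0, he.symm ▸ hc⟩

/-- Strong duality: the greedy partition has as many ascents as weak duality allows. -/
theorem exists_partition (X : Config κ) : ∃ A : Fin k → Set ℕ,
    (∀ i j, i ≠ j → Disjoint (A i) (A j)) ∧ (⋃ i, A i) = Set.univ ∧
    ∃ l e n, Attains X l e n ∧ (X.support.card : ℤ) + k * l ≤ (∑ i, NA (A i) X : ℕ) + n := by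
  classical
  have hdisj : ∀ i j : Fin k, i ≠ j → Disjoint {c | greedyClass k X c = i}
      {c | greedyClass k X c = j} := fun i j hij =>
    Set.disjoint_left.2 fun c hi hj => hij (Eq.trans (Eq.symm hi) hj)
  refine ⟨fun i => {c | greedyClass k X c = i}, hdisj, ?_, ?_⟩
  · ext c; simp
  · set e := X.support.sup id + 1
    obtain ⟨l, n, hn, hln⟩ := exists_attains_overflows (k := k) X e
    refine ⟨l, e, n, hn, ?_⟩
    rw [sum_NA_eq_card hdisj]
    have : X.support.card ≤ (X.support.filter
        fun b => ∃ i, b ∈ rises {c | greedyClass k X c = i} X).card + overflows k X 0 e := by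
      rw [overflows]
      refine (Finset.card_le_card fun b hb => ?_).trans (Finset.card_union_le _ _)
      rw [Finset.mem_union, Finset.mem_filter, Finset.mem_filter, Finset.mem_Ico]
      by_cases hov : IsOverflow k X b
      · have := Finset.le_sup (f := id) hb
        simp only [id] at this
        exact Or.inr ⟨⟨Nat.zero_le b, Nat.lt_succ_of_le this⟩, hov⟩
      · exact Or.inl ⟨hb, _, (mem_rises_greedyClass X b _).2 ⟨rfl, by simpa using hb, hov⟩⟩
    omega

end

/-! ### The dynamics of the blocks -/

/-- A block of `X` starts in box `p`. -/
def IsStart {κ : ℕ} (X : ℕ → Fin (κ + 1)) (p : ℕ) : Prop :=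
  X p ≠ 0 ∧ ∀ q, q + 1 = p → X q < X p

/-- A block of `X` ends in front of box `e`. -/
def IsEnd {κ : ℕ} (X : ℕ → Fin (κ + 1)) (e : ℕ) : Prop :=
  ∃ q, q + 1 = e ∧ X q ≠ 0 ∧ (X e = 0 ∨ X q < X e)

/-- The blocks of `X` are the words `w i`, starting in the boxes `p i`. -/
structure IsBlocking {κ : ℕ} (X : Config κ) {n : ℕ} (p : Fin n → ℕ)
    (w : Fin n → List (Fin (κ + 1))) : Prop where
  strictMono : StrictMono p
  isBlock : ∀ i, IsBlock X (p i) (w i)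
  cover : ∀ x, X x ≠ 0 → ∃ i, p i ≤ x ∧ x < p i + (w i).length

/-- The number of balls in the boxes `s, s + 1, …` whose color satisfies `P`. -/
def ballsFrom {κ : ℕ} (X : Config κ) (P : Fin (κ + 1) → Prop) [DecidablePred P] (s : ℕ) : ℕ :=
  (X.support.filter fun x => s ≤ x ∧ P (X x)).card

section

variable {κ : ℕ} {X : Config κ} {p : ℕ} {w : List (Fin (κ + 1))}

/-- If a block ends with the ball in box e, this ball is available at e + 1 and exceeds whatever was
released at e. If no block ends there, any color allowed at e + 1 was already in the carrier and
allowed at e, so the released colors cannot increase. -/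
theorem isStart_step_iff : IsStart (step X) p ↔ IsEnd X p := by
  cases p with
  | zero =>
    refine ⟨fun h => (h.1 ?_).elim, fun ⟨q, hq, _⟩ => absurd hq (Nat.succ_ne_zero q)⟩
    rw [step_apply]
    by_contra hc
    exact (release_mem hc).1.ne' rfl
  | succ e =>
    have h1 : IsStart (step X) (e + 1) ↔ step X e < step X (e + 1) := by
      constructor
      · exact fun h => h.2 e rfl
      · intro h
        refine ⟨(bot_le.trans_lt h).ne', fun q hq => ?_⟩
        rwa [Nat.succ_injective hq]
    have h2 : IsEnd X (e + 1) ↔ X e ≠ 0 ∧ (X (e + 1) = 0 ∨ X e < X (e + 1)) := by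
      constructor
      · rintro ⟨q, hq, h⟩
        rwa [Nat.succ_injective hq] at h
      · exact fun h => ⟨e, rfl, h⟩
    rw [h1, h2, step_apply, step_apply, carrier_succ (Nat.zero_le e)]
    set n := carrier X 0 e
    constructor
    · intro h
      by_contra hc
      refine h.not_ge ?_
      have hy := (bot_le.trans_lt h).ne'
      obtain ⟨h3, h4⟩ := release_mem hy
      generalize release (load n (X e)) (X (e + 1)) = y at h hy h3 h4 ⊢
      have h5 := load_add (n := n) (x := X e) hy
      rw [if_neg h.ne'] at h5
      have h6 : X e = 0 ∨ y < X e := by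
        by_contra! h7
        refine hc ⟨h7.1, h4.imp_right fun h8 => h7.2.trans_lt h8⟩
      have h7 : y ≠ X e := by
        rcases h6 with h6 | h6
        · exact h6 ▸ hy
        · exact h6.ne
      rw [if_neg h7] at h5
      exact le_release (by omega) h6
    · rintro ⟨h3, h4⟩
      have h5 := load_add (n := n) (x := X e) h3
      rw [if_pos rfl, if_neg (release_lt h3).ne'] at h5
      exact (release_lt h3).trans_le (le_release (by omega) h4)

theorem IsBlock.apply_ne_zero (h : IsBlock X p w) {x : ℕ} (hx : p ≤ x)
    (hx' : x < p + w.length) : X x ≠ 0 := by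
  obtain ⟨j, rfl⟩ := Nat.exists_eq_add_of_le hx
  rw [h.read j (by omega)]
  exact h.occupied _ (List.getElem_mem _)

theorem IsBlock.anti (h : IsBlock X p w) {x y : ℕ} (hx : p ≤ x) (hxy : x ≤ y)
    (hy : y < p + w.length) : X y ≤ X x := by
  rcases hxy.eq_or_lt with rfl | hxy
  · exact le_rfl
  obtain ⟨i, rfl⟩ := Nat.exists_eq_add_of_le hx
  obtain ⟨j, rfl⟩ := Nat.exists_eq_add_of_le (hx.trans hxy.le)
  rw [h.read i (by omega), h.read j (by omega)]
  exact List.pairwise_iff_getElem.1 h.nonincreasing i j _ _ (by omega)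

theorem IsBlock.length_pos (h : IsBlock X p w) : 0 < w.length :=
  List.length_pos_of_ne_nil h.ne_nil

theorem IsBlock.isStart (h : IsBlock X p w) : IsStart X p := by
  have hp := h.apply_ne_zero le_rfl (Nat.lt_add_of_pos_right h.length_pos)
  refine ⟨hp, fun q hq => ?_⟩
  rcases h.left_maximal q hq with h0 | h0
  · rw [h0]; exact Fin.pos_of_ne_zero hp
  · exact h0

theorem IsBlock.isEnd (h : IsBlock X p w) : IsEnd X (p + w.length) := by
  have := h.length_pos
  exact ⟨p + w.length - 1, by omega, h.apply_ne_zero (by omega) (by omega), h.right_maximal⟩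

theorem IsBlock.not_isStart (h : IsBlock X p w) {x : ℕ} (hx : p < x)
    (hx' : x < p + w.length) : ¬ IsStart X x := fun hs =>
  (hs.2 (x - 1) (by omega)).not_ge (h.anti (by omega) (by omega) hx')

theorem IsBlock.not_isEnd (h : IsBlock X p w) {x : ℕ} (hx : p < x)
    (hx' : x < p + w.length) : ¬ IsEnd X x := by
  rintro ⟨q, rfl, -, h0 | h0⟩
  · exact h.apply_ne_zero hx.le hx' h0
  · exact h0.not_ge (h.anti (by omega) (by omega) hx')

theorem exists_isBlock (h : IsStart X p) : ∃ w, IsBlock X p w := by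
  have hex : ∃ e, p < e ∧ IsEnd X e := by
    obtain ⟨⟨h1, h2⟩, h3⟩ := nextEmpty_spec X p
    refine ⟨_, h1, nextEmpty X p - 1, by omega, fun h0 => ?_, Or.inl h2⟩
    rcases Nat.lt_or_ge p (nextEmpty X p - 1) with h4 | h4
    · have := h3 ⟨h4, h0⟩; omega
    · exact h.1 (by rwa [show p = nextEmpty X p - 1 by omega])
  classical
  obtain ⟨hpe, hend⟩ := Nat.find_spec hex
  have hmin : ∀ m, m < Nat.find hex → ¬ (p < m ∧ IsEnd X m) := fun m => Nat.find_min hex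
  set e := Nat.find hex
  have hchain : ∀ j, p + j < e → X (p + j) ≠ 0 ∧ ∀ i, i ≤ j → X (p + j) ≤ X (p + i) := by
    intro j
    induction j with
    | zero =>
      intro _
      refine ⟨h.1, fun i hi => ?_⟩
      rw [Nat.le_zero.1 hi]
    | succ j ih =>
      intro hj
      obtain ⟨h0, hle⟩ := ih (by omega)
      have h1 : X (p + (j + 1)) ≠ 0 ∧ X (p + (j + 1)) ≤ X (p + j) := by
        by_contra hc
        refine hmin _ hj ⟨by omega, p + j, by omega, h0, ?_⟩
        by_contra! hc'
        exact hc hc'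
      refine ⟨h1.1, fun i hi => ?_⟩
      rcases Nat.lt_or_ge i (j + 1) with hi' | hi'
      · exact h1.2.trans (hle i (by omega))
      · rw [show i = j + 1 by omega]
  refine ⟨(List.range (e - p)).map fun j => X (p + j), ?_, ?_, ?_, ?_, ?_, ?_⟩
  · simp only [ne_eq, List.map_eq_nil_iff, List.range_eq_nil]; omega
  · intro j hj; simp
  · intro c hc
    obtain ⟨j, hj, rfl⟩ := List.mem_map.1 hc
    rw [List.mem_range] at hj
    exact (hchain j (by omega)).1
  · rw [List.pairwise_iff_getElem]
    intro i j hi hj hij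
    simp only [List.length_map, List.length_range] at hi hj
    simpa using (hchain j (by omega)).2 i hij.le
  · exact fun q hq => Or.inr (h.2 q hq)
  · obtain ⟨q, hq, hq0, hqe⟩ := hend
    simp only [List.length_map, List.length_range]
    rw [show p + (e - p) - 1 = q by omega, show p + (e - p) = e by omega]
    exact hqe

theorem exists_isStart_le (x : ℕ) (hx : X x ≠ 0) :
    ∃ p ≤ x, IsStart X p ∧ ∀ e, p < e → e ≤ x → ¬ IsEnd X e := by
  induction x with
  | zero => exact ⟨0, le_rfl, ⟨hx, fun q hq => absurd hq (Nat.succ_ne_zero q)⟩, by omega⟩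
  | succ x ih =>
    by_cases h : IsStart X (x + 1)
    · exact ⟨x + 1, le_rfl, h, by omega⟩
    · have hle : X (x + 1) ≤ X x := by
        by_contra! hc
        refine h ⟨hx, fun q hq => ?_⟩
        rwa [Nat.succ_injective hq]
      obtain ⟨p, hp, hps, hpe⟩ := ih ((Fin.pos_of_ne_zero hx).trans_le hle).ne'
      refine ⟨p, by omega, hps, fun e h1 h2 => ?_⟩
      rcases Nat.lt_or_ge x e with h3 | h3
      · rw [show e = x + 1 by omega]
        rintro ⟨q, hq, -, h4⟩
        rw [Nat.succ_injective hq] at h4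
        rcases h4 with h4 | h4
        · exact hx h4
        · exact h4.not_ge hle
      · exact hpe e h1 h3

theorem exists_isBlocking {n : ℕ} {p : Fin n → ℕ} (hp : StrictMono p)
    (hrange : Set.range p = {x | IsStart X x}) : ∃ w, IsBlocking X p w := by
  have hstart : ∀ i, IsStart X (p i) := fun i => by
    have : p i ∈ {x | IsStart X x} := hrange ▸ Set.mem_range_self i
    exact this
  choose w hw using fun i => exists_isBlock (hstart i)
  refine ⟨w, hp, hw, fun x hx => ?_⟩
  obtain ⟨q, hqx, hq, hqe⟩ := exists_isStart_le x hx
  obtain ⟨i, rfl⟩ : q ∈ Set.range p := hrange ▸ hq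
  refine ⟨i, hqx, ?_⟩
  by_contra! hc
  exact hqe _ (Nat.lt_add_of_pos_right (hw i).length_pos) hc (hw i).isEnd

theorem exists_isBlocking_card (X : Config κ) :
    ∃ (n : ℕ) (p : Fin n → ℕ) (w : Fin n → List (Fin (κ + 1))), IsBlocking X p w := by
  classical
  have hrange : Set.range ((X.support.filter (IsStart X)).orderEmbOfFin rfl) =
      {x | IsStart X x} := by
    rw [Finset.range_orderEmbOfFin]
    ext x
    simpa using fun h : IsStart X x => h.1
  obtain ⟨w, hw⟩ := exists_isBlocking (OrderEmbedding.strictMono _) hrange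
  exact ⟨_, _, w, hw⟩

end

namespace IsBlocking

variable {κ n : ℕ} {X : Config κ} {p : Fin n → ℕ} {w : Fin n → List (Fin (κ + 1))}

theorem range_eq (h : IsBlocking X p w) : Set.range p = {x | IsStart X x} := by
  ext x
  constructor
  · rintro ⟨i, rfl⟩
    exact (h.isBlock i).isStart
  · intro hx
    have hx : IsStart X x := hx
    obtain ⟨i, h1, h2⟩ := h.cover x hx.1
    rcases h1.eq_or_lt with h1 | h1
    · exact ⟨i, h1⟩
    · exact ((h.isBlock i).not_isStart h1 h2 hx).elim

theorem end_le (h : IsBlocking X p w) {i j : Fin n} (hij : i < j) :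
    p i + (w i).length ≤ p j := by
  by_contra! hc
  exact (h.isBlock i).not_isStart (h.strictMono hij) hc (h.isBlock j).isStart

theorem end_strictMono (h : IsBlocking X p w) :
    StrictMono fun i => p i + (w i).length := fun _ j hij =>
  (h.end_le hij).trans_lt (Nat.lt_add_of_pos_right (h.isBlock j).length_pos)

theorem range_end_eq (h : IsBlocking X p w) :
    Set.range (fun i => p i + (w i).length) = {x | IsEnd X x} := by
  ext x
  constructor
  · rintro ⟨i, rfl⟩
    exact (h.isBlock i).isEnd
  · intro hx
    obtain ⟨q, rfl, hq, h0⟩ : IsEnd X x := hx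
    obtain ⟨i, h1, h2⟩ := h.cover q hq
    refine ⟨i, ?_⟩
    by_contra hne
    exact (h.isBlock i).not_isEnd (x := q + 1) (by omega)
      (lt_of_le_of_ne (by omega) (Ne.symm hne)) ⟨q, rfl, hq, h0⟩

theorem range_end_eq_step (h : IsBlocking X p w) :
    Set.range (fun i => p i + (w i).length) = {x | IsStart (step X) x} := by
  rw [h.range_end_eq]
  ext x
  exact isStart_step_iff.symm

/-- In a time step each block moves forward by its length. -/
theorem start_step (h : IsBlocking X p w) {p' : Fin n → ℕ} {w' : Fin n → List (Fin (κ + 1))}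
    (h' : IsBlocking (step X) p' w') (i : Fin n) : p' i = p i + (w i).length := by
  have := (StrictMono.range_inj h'.strictMono h.end_strictMono).1
    (h'.range_eq.trans h.range_end_eq_step.symm)
  rw [this]

theorem exists_trajectory (h : IsBlocking X p w) (t : ℕ) :
    ∃ (p' : Fin n → ℕ) (w' : Fin n → List (Fin (κ + 1))),
      IsBlocking (trajectory X t) p' w' := by
  induction t with
  | zero => exact ⟨p, w, h⟩
  | succ t ih =>
    obtain ⟨p', w', h'⟩ := ih
    rw [trajectory_succ]
    exact ⟨_, exists_isBlocking h'.end_strictMono h'.range_end_eq_step⟩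

end IsBlocking

section

variable {κ : ℕ} {X : Config κ} {p : ℕ} {w : List (Fin (κ + 1))}
  {P : Fin (κ + 1) → Prop} [DecidablePred P]

/-- The balls that cross into the boxes from `s` onwards are those in the carrier in front of `s`,
and all of them are put down eventually. -/
theorem ballsFrom_step (X : Config κ) (P : Fin (κ + 1) → Prop) [DecidablePred P] (s : ℕ) :
    ballsFrom (step X) P s = ballsFrom X P s + mass (carrier X 0 s) P := by
  have key : ∀ e, s ≤ e →
      ((Finset.Ico s e).filter fun x => X x ≠ 0 ∧ P (X x)).card + mass (carrier X 0 s) P =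
      ((Finset.Ico s e).filter fun x => step X x ≠ 0 ∧ P (step X x)).card +
        mass (carrier X 0 e) P := by
    intro e he
    induction e, he using Nat.le_induction with
    | base => simp
    | succ e he ih =>
      have h1 := mass_load (x := X e) (carrier_apply_zero (X := X) (s := 0) (e := e)) P
      rw [← step_apply] at h1
      rw [← Finset.insert_Ico_right_eq_Ico_add_one he, Finset.filter_insert,
        Finset.filter_insert, carrier_succ (Nat.zero_le e)]
      split_ifs at h1 ⊢ <;>
        (repeat rw [Finset.card_insert_of_notMem (by simp)]) <;> omega
  have hfin : ∀ (Z : Config κ) e, Z.support.sup id < e → ballsFrom Z P s =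
      ((Finset.Ico s e).filter fun x => Z x ≠ 0 ∧ P (Z x)).card := by
    intro Z e he
    unfold ballsFrom
    congr 1
    ext x
    simp only [Finset.mem_filter, Finsupp.mem_support_iff, Finset.mem_Ico]
    constructor
    · rintro ⟨h0, hs, hP⟩
      have := Finset.le_sup (f := id) (Finsupp.mem_support_iff.2 h0)
      simp only [id] at this
      exact ⟨⟨hs, by omega⟩, h0, hP⟩
    · rintro ⟨⟨hs, -⟩, h0, hP⟩
      exact ⟨h0, hs, hP⟩
  obtain ⟨E, hE⟩ := exists_size_carrier_eq_zero X
  have h1 := key (s + E + X.support.sup id + (step X).support.sup id + 1) (by omega)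
  rw [← hfin X _ (by omega), ← hfin (step X) _ (by omega)] at h1
  have h2 := hE (s + E + X.support.sup id + (step X).support.sup id + 1) (by omega) 0
  have h3 : mass (carrier X 0 (s + E + X.support.sup id + (step X).support.sup id + 1)) P ≤
      size (carrier X 0 (s + E + X.support.sup id + (step X).support.sup id + 1)) :=
    Finset.sum_le_sum_of_subset (Finset.filter_subset _ _)
  omega

theorem ballsFrom_zero_trajectory (X : Config κ) (P : Fin (κ + 1) → Prop) [DecidablePred P]
    (t : ℕ) : ballsFrom (trajectory X t) P 0 = ballsFrom X P 0 := by
  induction t with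
  | zero => rfl
  | succ t ih =>
    rw [trajectory_succ, ballsFrom_step, ih]
    simp [carrier_eq_zero, mass]

theorem ballsFrom_le (X : Config κ) (P : Fin (κ + 1) → Prop) [DecidablePred P] {s s' : ℕ}
    (h : s ≤ s') : ballsFrom X P s' ≤ ballsFrom X P s :=
  Finset.card_le_card fun x hx => by
    rw [Finset.mem_filter] at hx ⊢
    exact ⟨hx.1, h.trans hx.2.1, hx.2.2⟩

theorem IsBlock.ballsFrom_eq (h : IsBlock X p w) :
    ballsFrom X P p = w.countP P + ballsFrom X P (p + w.length) := by
  have key : ∀ j ≤ w.length, ballsFrom X P p = (w.take j).countP P + ballsFrom X P (p + j) := by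
    intro j hj
    induction j with
    | zero => simp
    | succ j ih =>
      rw [ih (by omega), List.take_succ_eq_append_getElem (by omega), List.countP_append,
        add_assoc]
      congr 1
      have hX := h.read j (by omega)
      have h0 := h.apply_ne_zero (x := p + j) (by omega) (by omega)
      unfold ballsFrom
      rw [List.countP_singleton, ← hX]
      by_cases hP : P (X (p + j))
      · have : (X.support.filter fun x => p + j ≤ x ∧ P (X x)) =
            insert (p + j) (X.support.filter fun x => p + (j + 1) ≤ x ∧ P (X x)) := by
          ext x
          simp only [Finset.mem_filter, Finset.mem_insert, Finsupp.mem_support_iff]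
          constructor
          · rintro ⟨h1, h2, h3⟩
            rcases h2.eq_or_lt with h2 | h2
            · exact Or.inl h2.symm
            · exact Or.inr ⟨h1, by omega, h3⟩
          · rintro (rfl | ⟨h1, h2, h3⟩)
            · exact ⟨h0, le_rfl, hP⟩
            · exact ⟨h1, by omega, h3⟩
        rw [this, Finset.card_insert_of_notMem (by simp)]
        simp [hP, add_comm]
      · simp only [hP, decide_false, Bool.false_eq_true, if_false, zero_add]
        congr 1
        refine Finset.filter_congr fun x _ => ⟨fun ⟨h2, h3⟩ => ⟨?_, h3⟩, fun ⟨h2, h3⟩ =>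
          ⟨by omega, h3⟩⟩
        have : x ≠ p + j := by rintro rfl; exact hP h3
        omega
  simpa using key w.length le_rfl

/-- At the end of a block the carrier contains all the balls of the block. -/
theorem IsBlock.count_le_carrier (h : IsBlock X p w) (a : Fin (κ + 1)) :
    w.count a ≤ carrier X 0 (p + w.length) a := by
  by_cases ha : a = 0
  · rw [List.count_eq_zero_of_not_mem]
    · exact Nat.zero_le _
    · exact fun h' => h.occupied a h' ha
  have key : ∀ j ≤ w.length, (w.take j).count a ≤ carrier X 0 (p + j) a := by
    intro j hj
    induction j with
    | zero => simp
    | succ j ih =>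
      have ih := ih (by omega)
      have hX := h.read j (by omega)
      have h0 := h.apply_ne_zero (x := p + j) (by omega) (by omega)
      rw [← add_assoc, carrier_succ (Nat.zero_le _)]
      have h1 := load_add (n := carrier X 0 (p + j)) (x := X (p + j)) ha
      -- A color released inside the block is smaller than the ball met there, hence smaller than
      -- everything the block has shown so far.
      by_cases hy : a = release (carrier X 0 (p + j)) (X (p + j))
      · have h2 := release_lt (n := carrier X 0 (p + j)) h0
        rw [← hy] at h2
        rw [List.count_eq_zero_of_not_mem]
        · exact Nat.zero_le _
        · intro h3
          obtain ⟨i, hi, rfl⟩ := List.mem_iff_getElem.1 h3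
          rw [List.getElem_take, ← h.read i (by simp at hi; omega)] at h2
          simp only [List.length_take] at hi
          exact h2.not_ge (h.anti (by omega) (by omega) (by omega))
      · rw [if_neg hy] at h1
        rw [List.take_succ_eq_append_getElem (by omega), List.count_append,
          List.count_singleton, ← hX]
        simp only [beq_iff_eq]
        by_cases hx : a = X (p + j)
        · rw [if_pos hx] at h1
          rw [if_pos hx.symm]
          omega
        · rw [if_neg hx] at h1
          rw [if_neg (Ne.symm hx)]
          omega
  simpa using key w.length le_rfl

end

namespace IsBlocking

variable {κ n : ℕ} {X : Config κ} {p : Fin n → ℕ} {w : Fin n → List (Fin (κ + 1))}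
  {P : Fin (κ + 1) → Prop} [DecidablePred P]

theorem ballsFrom_end (h : IsBlocking X p w) (i : Fin n) :
    ballsFrom X P (p i + (w i).length) =
      if h : (i : ℕ) + 1 < n then ballsFrom X P (p ⟨i + 1, h⟩) else 0 := by
  have hgt : ∀ x, p i + (w i).length ≤ x → X x ≠ 0 → ∃ j, i < j ∧ p j ≤ x := by
    intro x hx h0
    obtain ⟨j, h1, h2⟩ := h.cover x h0
    refine ⟨j, ?_, h1⟩
    by_contra! hc
    have := h.end_strictMono.monotone hc
    change p j + (w j).length ≤ p i + (w i).length at this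
    omega
  split_ifs with hi
  · unfold ballsFrom
    congr 1
    refine Finset.filter_congr fun x hx => ⟨fun ⟨h1, h2⟩ => ⟨?_, h2⟩, fun ⟨h1, h2⟩ =>
      ⟨(h.end_le ?_).trans h1, h2⟩⟩
    · obtain ⟨j, hij, hj⟩ := hgt x h1 (by simpa using hx)
      refine (h.strictMono.monotone ?_).trans hj
      rw [Fin.le_def]
      exact hij
    · rw [Fin.lt_def]; exact Nat.lt_succ_self _
  · rw [ballsFrom, Finset.card_eq_zero, Finset.filter_eq_empty_iff]
    rintro x hx ⟨h1, -⟩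
    obtain ⟨j, hij, -⟩ := hgt x h1 (by simpa using hx)
    rw [Fin.lt_def] at hij
    have := j.is_lt
    omega

theorem ballsFrom_congr {X' : Config κ} {p' : Fin n → ℕ} (h : IsBlocking X p w)
    (h' : IsBlocking X' p' w) (i : Fin n) : ballsFrom X P (p i) = ballsFrom X' P (p' i) := by
  obtain ⟨m, hm⟩ : ∃ m, m = n - i := ⟨_, rfl⟩
  induction m using Nat.strong_induction_on generalizing i with
  | _ m ih =>
    rw [(h.isBlock i).ballsFrom_eq, (h'.isBlock i).ballsFrom_eq, h.ballsFrom_end,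
      h'.ballsFrom_end]
    split_ifs with hi
    · rw [ih (n - (i + 1)) (by omega) ⟨i + 1, hi⟩ rfl]
    · rfl

/-- With the same words before and after the step, the number of balls from block `i` onwards is
unchanged. Its new start is its old end, so the balls carried across that point make up for exactly
one block. -/
theorem size_carrier_end {p' : Fin n → ℕ} (h : IsBlocking X p w)
    (h' : IsBlocking (step X) p' w) (i : Fin n) :
    size (carrier X 0 (p i + (w i).length)) = (w i).length := by
  have h1 := h.ballsFrom_congr (P := fun _ => True) h' i
  rw [h.start_step h', ballsFrom_step, (h.isBlock i).ballsFrom_eq, mass_eq_size (by simp)] at h1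
  simp only [decide_true, List.countP_true] at h1
  omega

theorem support_card (h : IsBlocking X p w) : X.support.card = ∑ i, (w i).length := by
  have h1 : X.support =
      Finset.univ.biUnion fun i => Finset.Ico (p i) (p i + (w i).length) := by
    ext x
    simp only [Finsupp.mem_support_iff, Finset.mem_biUnion, Finset.mem_univ, true_and,
      Finset.mem_Ico]
    exact ⟨h.cover x, fun ⟨i, h1, h2⟩ => (h.isBlock i).apply_ne_zero h1 h2⟩
  rw [h1, Finset.card_biUnion]
  · simp
  · intro i _ j _ hij
    rw [Function.onFun, Finset.disjoint_left]
    intro x hx hx'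
    rw [Finset.mem_Ico] at hx hx'
    rcases lt_or_gt_of_ne hij with h2 | h2 <;> have := h.end_le h2 <;> omega

theorem hasBlocks (h : IsBlocking X p w) : HasBlocks X (List.ofFn w) := by
  have hlen : (List.ofFn w).length = n := List.length_ofFn
  have hget : ∀ i : Fin (List.ofFn w).length, (List.ofFn w).get i = w (Fin.cast hlen i) := by
    intro i; simp; rfl
  refine ⟨fun i => p (Fin.cast hlen i), ?_, ?_, ?_⟩
  · intro i j hij; exact h.strictMono (by simpa using hij)
  · intro i; rw [hget]; exact h.isBlock _
  · intro x hx
    obtain ⟨i, h1, h2⟩ := h.cover x hx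
    refine ⟨Fin.cast hlen.symm i, ?_⟩
    rw [hget]
    exact ⟨h1, h2⟩

end IsBlocking

theorem HasBlocks.exists_isBlocking {κ : ℕ} {X : Config κ} {W : List (List (Fin (κ + 1)))}
    (h : HasBlocks X W) : ∃ p, IsBlocking X p W.get := by
  obtain ⟨p, h1, h2, h3⟩ := h
  exact ⟨p, h1, h2, h3⟩

theorem exists_forall_eq_of_monotone {f : ℕ → ℕ} (hf : Monotone f) {B : ℕ} (hB : ∀ t, f t ≤ B) :
    ∃ T, ∀ t, T ≤ t → f t = f T := by
  obtain ⟨-, ⟨T, rfl⟩, hmax⟩ := Set.exists_max_image (Set.range f) id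
    ((Set.finite_Iic B).subset (by rintro - ⟨t, rfl⟩; exact hB t)) ⟨_, 0, rfl⟩
  exact ⟨T, fun t ht => le_antisymm (hmax _ ⟨t, rfl⟩) (hf ht)⟩

/-- Every trajectory is decomposed into solitons from some time on. -/
theorem exists_isSolitonDecomposition {κ : ℕ} (X : Config κ) :
    ∃ T W, IsSolitonDecomposition X T W := by
  obtain ⟨n, p₀, w₀, h₀⟩ := exists_isBlocking_card X
  choose p w h using fun t => h₀.exists_trajectory t
  have hstep : ∀ t i, p (t + 1) i = p t i + (w t i).length := fun t i =>
    (h t).start_step (trajectory_succ X t ▸ h (t + 1)) i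
  have hM : ∀ i a t, ballsFrom (trajectory X t) (· = a) (p t i) + carrier (trajectory X t) 0
      (p t i + (w t i).length) a = ballsFrom (trajectory X (t + 1)) (· = a) (p (t + 1) i) +
      (w t i).count a := by
    intro i a t
    rw [trajectory_succ, hstep, ballsFrom_step, ((h t).isBlock i).ballsFrom_eq]
    have : mass (carrier (trajectory X t) 0 (p t i + (w t i).length)) (· = a) =
        carrier (trajectory X t) 0 (p t i + (w t i).length) a := by
      simp [mass, Finset.filter_eq']
    rw [this, show (w t i).countP (fun x => decide (x = a)) = (w t i).count a by
      simp [List.count, beq_eq_decide]]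
    omega
  -- At the end of block `i` the carrier holds at least the balls of the block, so the new count
  -- from there dominates the old count from its start.
  have hmono : ∀ i a, Monotone fun t => ballsFrom (trajectory X t) (· = a) (p t i) := by
    intro i a
    refine monotone_nat_of_le_succ fun t => ?_
    have h1 := hM i a t
    have h2 := ((h t).isBlock i).count_le_carrier a
    omega
  have hev : ∃ T, ∀ i a t, T ≤ t → ballsFrom (trajectory X t) (· = a) (p t i) =
      ballsFrom (trajectory X T) (· = a) (p T i) := by
    have hex : ∀ ia : Fin n × Fin (κ + 1), ∃ T, ∀ t, T ≤ t →
        ballsFrom (trajectory X t) (· = ia.2) (p t ia.1) =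
          ballsFrom (trajectory X T) (· = ia.2) (p T ia.1) := fun ia =>
      exists_forall_eq_of_monotone (hmono ia.1 ia.2) (B := ballsFrom X (· = ia.2) 0)
        fun t => ballsFrom_zero_trajectory X (· = ia.2) t ▸ ballsFrom_le _ _ (Nat.zero_le _)
    choose T hT using hex
    refine ⟨Finset.univ.sup T, fun i a t ht => ?_⟩
    have h1 : T (i, a) ≤ Finset.univ.sup T := Finset.le_sup (Finset.mem_univ _)
    rw [hT (i, a) t (h1.trans ht), hT (i, a) _ h1]
  obtain ⟨T, hT⟩ := hev
  -- The color content of a block is the difference of two consecutive constant counts; being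
  -- sorted, the word is determined by it.
  have hcount : ∀ i a t, T ≤ t → (w t i).count a = (w T i).count a := by
    have key : ∀ i a t, (w t i).count a + (if hi : (i : ℕ) + 1 < n then
        ballsFrom (trajectory X t) (· = a) (p t ⟨i + 1, hi⟩) else 0) =
        ballsFrom (trajectory X t) (· = a) (p t i) := by
      intro i a t
      rw [((h t).isBlock i).ballsFrom_eq, (h t).ballsFrom_end]
      simp [List.count, beq_eq_decide]
    intro i a t ht
    have h1 := key i a t
    have h2 := key i a T
    rw [hT i a t ht] at h1
    split_ifs at h1 h2 with hi
    · rw [hT ⟨i + 1, hi⟩ a t ht] at h1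
      omega
    · omega
  have hw : ∀ t, T ≤ t → w t = w T := by
    intro t ht
    funext i
    refine List.Perm.eq_of_pairwise (le := fun c d => d ≤ c) (fun a b _ _ h1 h2 => le_antisymm h2 h1)
      ((h t).isBlock i).nonincreasing ((h T).isBlock i).nonincreasing
      (List.perm_iff_count.2 fun a => hcount i a t ht)
  refine ⟨T, List.ofFn (w T), ?_, fun t ht => hw t ht ▸ (h t).hasBlocks⟩
  have hlin : ∀ i m, p (T + m) i = p T i + m * (w T i).length := by
    intro i m
    induction m with
    | zero => simp
    | succ m ih => rw [← add_assoc, hstep, ih, hw (T + m) (by omega)]; ring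
  rw [List.map_ofFn, List.pairwise_ofFn]
  intro i j hij
  -- A longer block on the left would gain at least one box per step on block `j`, and so catch up
  -- within `p T j` steps.
  by_contra! hc
  have h1 := (h (T + p T j)).strictMono hij
  rw [hlin, hlin] at h1
  have h2 : p T j * ((w T j).length + 1) ≤ p T j * (w T i).length := Nat.mul_le_mul_left _ hc
  rw [mul_add, mul_one] at h2
  linarith [Nat.zero_le (p T i)]

/-! ### Penalized lengths after the decomposition into solitons -/

/-- The sum of the last `l` among `c 0, …, c (j - 1)`. -/
def lastSum (c : ℕ → ℕ) : ℕ → ℕ → ℕ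
  | 0, _ => 0
  | _ + 1, 0 => 0
  | l + 1, j + 1 => c j + lastSum c l j

section

variable {c : ℕ → ℕ} {l : ℕ}

theorem lastSum_le_succ (l j : ℕ) : lastSum c l j ≤ lastSum c (l + 1) j := by
  induction l generalizing j with
  | zero => simp [lastSum]
  | succ l ih =>
    cases j with
    | zero => simp [lastSum]
    | succ j => exact Nat.add_le_add_left (ih j) _

theorem lastSum_mono {n i j : ℕ} (hc : ∀ i, i + 1 < n → c i ≤ c (i + 1)) (hij : i ≤ j)
    (hj : j ≤ n) : lastSum c l i ≤ lastSum c l j := by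
  induction j, hij using Nat.le_induction with
  | base => rfl
  | succ j hij ih =>
    refine (ih (by omega)).trans ?_
    clear ih hij
    induction l generalizing j with
    | zero => simp [lastSum]
    | succ l ih =>
      cases j with
      | zero => simp [lastSum]
      | succ j => exact Nat.add_le_add (hc j (by omega)) (ih j (by omega))

theorem lastSum_eq_sum (l j : ℕ) :
    lastSum c l j = ∑ i ∈ Finset.range l, if i < j then c (j - 1 - i) else 0 := by
  induction l generalizing j with
  | zero => simp [lastSum]
  | succ l ih =>
    cases j with
    | zero => simp [lastSum]
    | succ j =>
      rw [lastSum, ih, Finset.sum_range_succ', add_comm]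
      congr 1
      · refine Finset.sum_congr rfl fun i _ => ?_
        simp only [Nat.succ_lt_succ_iff, show j + 1 - 1 - (i + 1) = j - 1 - i by omega]

end

/-- The blocks of `X` are the intervals `[P i, E i)` with `i < n`, their lengths are
non-decreasing, and in front of box `E i` the carrier has as many balls as block `i`. -/
structure IsSorted {κ : ℕ} (X : Config κ) (n : ℕ) (P E : ℕ → ℕ) : Prop where
  start_lt : ∀ i < n, P i < E i
  end_le : ∀ j < n, ∀ i < j, E i ≤ P j
  cover : ∀ x, X x ≠ 0 → ∃ i < n, P i ≤ x ∧ x < E i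
  ne_zero : ∀ i < n, ∀ x, P i ≤ x → x < E i → X x ≠ 0
  anti : ∀ i < n, ∀ x y, P i ≤ x → x ≤ y → y < E i → X y ≤ X x
  length_le : ∀ i, i + 1 < n → E i - P i ≤ E (i + 1) - P (i + 1)
  size_eq : ∀ i < n, size (carrier X 0 (E i)) = E i - P i

namespace IsSorted

variable {κ : ℕ} {X : Config κ} {n : ℕ} {P E : ℕ → ℕ}

theorem lastSum_mono (h : IsSorted X n P E) {l i j : ℕ} (hij : i ≤ j) (hj : j ≤ n) :
    lastSum (fun i => E i - P i) l i ≤ lastSum (fun i => E i - P i) l j :=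
  BoxBall.lastSum_mono h.length_le hij hj

/-- A window that ends in a block may be prolonged to the end of the block. -/
theorem card_add_le (h : IsSorted X n P E) {i b c : ℕ} (hi : i < n) (hPb : P i ≤ b)
    (hbE : b < E i) (hcb : c ≤ b) {A : Finset ℕ} (hbA : b ∈ A)
    (hA : IsWindow X 0 c (b + 1) A) :
    A.card + (E i - (b + 1)) ≤ (E i - P i) + zeros X c (b + 1) := by
  have key : ∀ d, b + 1 ≤ d → d ≤ E i → ∃ B, IsWindow X (X (d - 1)) c d B ∧
      B.card = A.card + (d - (b + 1)) ∧ zeros X c d = zeros X c (b + 1) := by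
    intro d hd
    induction d, hd using Nat.le_induction with
    | base =>
      intro _
      refine ⟨A, ⟨hA.mem, hA.ne_zero, fun a ha => ?_, hA.anti⟩, by omega, rfl⟩
      exact hA.anti a ha b hbA (Nat.le_of_lt_succ (hA.mem a ha).2)
    | succ d hd ih =>
      intro hdE
      obtain ⟨B, hB, hBc, hz⟩ := ih (by omega)
      have h0 := h.ne_zero i hi d (by omega) (by omega)
      have hle := h.anti i hi (d - 1) d (by omega) (by omega) (by omega)
      obtain ⟨hB', hcard⟩ := (hB.mono hle le_rfl le_rfl).insert (by omega) h0 le_rfl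
      refine ⟨_, hB', by omega, ?_⟩
      rw [zeros_succ (by omega), if_neg h0, hz, add_zero]
  obtain ⟨B, hB, hBc, hz⟩ := key (E i) hbE le_rfl
  -- The prolonged window is bounded by the load at the end of the block, which is the length of the
  -- block.
  have h1 := (hB.mono (Fin.zero_le _) le_rfl le_rfl).card_le (Nat.zero_le c)
  rw [mass_eq_size fun _ => Fin.zero_le _, h.size_eq i hi] at h1
  omega

/-- Joint induction on `l`. In the second bound the cut `s` lies in block `i`, and the unused rest
of the block counts as a further set. For a new set with last ball in block `i`, there are two
cases: if the previous cut is in front of the block, the set is worth at most the whole block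
(`card_add_le`); if it is inside, the set has at most as many elements as there are boxes, which the
rest of the block pays for. The sorted lengths allow a change to later blocks. -/
theorem attains_le (h : IsSorted X n P E) (l : ℕ) :
    (∀ j ≤ n, ∀ s m, (j < n → s ≤ P j) → Attains X l s m →
      m ≤ lastSum (fun i => E i - P i) l j) ∧
    (∀ i < n, ∀ s m, P i ≤ s → s ≤ E i → Attains X l s m →
      m + (E i - s : ℕ) ≤ lastSum (fun i => E i - P i) (l + 1) (i + 1)) := by
  induction l with
  | zero =>
    refine ⟨fun j _ s m _ hm => ?_, fun i hi s m hs hsE hm => ?_⟩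
    · have hm : m = 0 := hm
      simp [hm]
    · have hm : m = 0 := hm
      simp only [hm, lastSum]
      omega
  | succ l ih =>
    obtain ⟨ih₁, ih₂⟩ := ih
    have hsucc := fun l j => lastSum_le_succ (c := fun i => E i - P i) l j
    have hS : ∀ l i, lastSum (fun i => E i - P i) (l + 1) (i + 1) =
        (E i - P i) + lastSum (fun i => E i - P i) l i := fun _ _ => rfl
    have core : ∀ i < n, ∀ s m, Attains X l s m → ∀ c b A, s ≤ c → c ≤ b → P i ≤ b → b < E i →
        b ∈ A → IsWindow X 0 c (b + 1) A → ∀ L : ℤ, L + zeros X c (b + 1) ≤ A.card →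
        m + L ≤ lastSum (fun i => E i - P i) (l + 1) (i + 1) := by
      intro i hi s m hm c b A hsc hcb hPb hbE hbA hA L hL
      rcases Nat.lt_or_ge s (P i) with hs | hs
      · have h1 := ih₁ i hi.le s m (fun _ => hs.le) hm
        have h2 := h.card_add_le hi hPb hbE hcb hbA hA
        rw [hS]
        omega
      · have h1 := ih₂ i hi s m hs (by omega) hm
        have h2 : A.card ≤ (Finset.Ico c (b + 1)).card :=
          Finset.card_le_card fun a ha => Finset.mem_Ico.2 (hA.mem a ha)
        rw [Nat.card_Ico] at h2
        omega
    have first : ∀ j ≤ n, ∀ s m, (j < n → s ≤ P j) → Attains X (l + 1) s m →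
        m ≤ lastSum (fun i => E i - P i) (l + 1) j := by
      rintro j hj s m hsP ⟨s', hs', A, hA, hm⟩
      rcases penalizedLength_le A X with h0 | ⟨c, hc, b, hb, hcb, A', -, hbA', hA', hcard⟩
      · have h1 := ih₁ j hj s' _ (fun hjn => hs'.trans (hsP hjn)) hm
        have h2 := hsucc l j
        omega
      · obtain ⟨i, hi, hPb, hbE⟩ := h.cover b (hA'.ne_zero b hbA')
        have hij : i < j := by
          by_contra! hc'
          have h1 := hsP (by omega)
          have h2 := (hA b hb).2
          rcases hc'.eq_or_lt with rfl | h3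
          · omega
          · have h4 := h.end_le i hi j h3
            have h5 := h.start_lt j (by omega)
            omega
        have h1 := core i hi s' _ hm c b A' (hA c hc).1 hcb hPb hbE hbA' hA' _ hcard
        have h2 := h.lastSum_mono (l := l + 1) (show i + 1 ≤ j from hij) hj
        omega
    refine ⟨first, ?_⟩
    rintro i hi s m hPs hsE hm
    obtain ⟨s', hs', A, hA, hm'⟩ := hm
    have h2 := hsucc (l + 1) (i + 1)
    rcases penalizedLength_le A X with h0 | ⟨c, hc, b, hb, hcb, A', hsub, hbA', hA', hcard⟩
    · rcases Nat.lt_or_ge s' (P i) with hs | hs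
      · have h1 := ih₁ i hi.le s' _ (fun _ => hs.le) hm'
        have h3 := hS l i
        omega
      · have h1 := ih₂ i hi s' _ hs (by omega) hm'
        omega
    · have hbs := (hA b hb).2
      have hsc := (hA c hc).1
      rcases Nat.lt_or_ge b (P i) with hbP | hbP
      · obtain ⟨j, hj, hPb, hbE⟩ := h.cover b (hA'.ne_zero b hbA')
        have hji : j < i := by
          by_contra! hc'
          rcases hc'.eq_or_lt with rfl | h3
          · omega
          · have h4 := h.end_le j hj i h3
            have h5 := h.start_lt i hi
            omega
        have h1 := core j hj s' _ hm' c b A' hsc hcb hPb hbE hbA' hA' _ hcard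
        have h3 := h.lastSum_mono (l := l + 1) (show j + 1 ≤ i from hji) hi.le
        have h4 := hS (l + 1) i
        omega
      · rcases Nat.lt_or_ge s' (P i) with hs | hs
        · have h1 := ih₁ i hi.le s' _ (fun _ => hs.le) hm'
          have h3 := h.card_add_le hi hbP (by omega) hcb hbA' hA'
          have h4 := hS l i
          omega
        · have h1 := ih₂ i hi s' _ hs (by omega) hm'
          have h3 : A'.card ≤ (Finset.Ico s' s).card :=
            Finset.card_le_card fun a ha => Finset.mem_Ico.2 (hA a (hsub ha))
          rw [Nat.card_Ico] at h3
          omega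

/-- The last `l` of the first `j` blocks are themselves windows without empty boxes; missing blocks
are replaced by empty sets. -/
theorem exists_attains (h : IsSorted X n P E) (l : ℕ) : ∀ j ≤ n, ∃ e m,
    (j < n → e ≤ P j) ∧ Attains X l e m ∧ (lastSum (fun i => E i - P i) l j : ℤ) ≤ m := by
  induction l with
  | zero => exact fun j _ => ⟨0, 0, fun _ => Nat.zero_le _, rfl, by simp [lastSum]⟩
  | succ l ih =>
    intro j hj
    cases j with
    | zero =>
      obtain ⟨e, m, he, hm, hle⟩ := ih 0 hj
      refine ⟨e, m, he, hm.append_empty, ?_⟩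
      have : lastSum (fun i => E i - P i) (l + 1) 0 = 0 := rfl
      rw [this]
      exact le_trans (by positivity) hle
    | succ j =>
      obtain ⟨e, m, he, hm, hle⟩ := ih j (by omega)
      have hPE := h.start_lt j (by omega)
      have hwin : IsWindow X 0 (P j) (E j) (Finset.Ico (P j) (E j)) := by
        refine ⟨fun a ha => Finset.mem_Ico.1 ha, fun a ha => ?_, fun _ _ => Fin.zero_le _,
          fun a ha b hb hab => ?_⟩
        · rw [Finset.mem_Ico] at ha
          exact h.ne_zero j (by omega) a ha.1 ha.2
        · rw [Finset.mem_Ico] at ha hb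
          exact h.anti j (by omega) a b ha.1 hab hb.2
      have hz : zeros X (P j) (E j) = 0 := by
        rw [zeros, Finset.card_eq_zero, Finset.filter_eq_empty_iff]
        intro a ha
        rw [Finset.mem_Ico] at ha
        exact h.ne_zero j (by omega) a ha.1 ha.2
      have hcard := hwin.card_le_penalizedLength
      rw [hz, Nat.card_Ico] at hcard
      refine ⟨E j, _, fun hj' => h.end_le _ hj' j (Nat.lt_succ_self j),
        (hm.mono (he (by omega))).append hPE.le hwin.mem, ?_⟩
      rw [lastSum]
      push_cast
      omega

theorem isMaxSum (h : IsSorted X n P E) (l : ℕ) :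
    IsMaxSum X l (lastSum (fun i => E i - P i) l n) := by
  have hle : ∀ e m, Attains X l e m → m ≤ lastSum (fun i => E i - P i) l n := fun e m hm =>
    (h.attains_le l).1 n le_rfl e m (fun h => absurd h (lt_irrefl n)) hm
  obtain ⟨e, m, -, hm, hlem⟩ := h.exists_attains l n le_rfl
  exact ⟨⟨e, le_antisymm (hle e m hm) hlem ▸ hm⟩, hle⟩

end IsSorted

section

variable {κ : ℕ} {X : Config κ} {T : ℕ} {W : List (List (Fin (κ + 1)))}

theorem IsSolitonDecomposition.isMaxSum (h : IsSolitonDecomposition X T W) (l : ℕ) :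
    IsMaxSum X l (∑ j ∈ Finset.range l, ((W.map List.length).reverse.getD j 0 : ℤ)) := by
  obtain ⟨hsort, hblocks⟩ := h
  obtain ⟨p, hp⟩ := (hblocks T le_rfl).exists_isBlocking
  obtain ⟨p', hp'⟩ := (hblocks (T + 1) (Nat.le_succ T)).exists_isBlocking
  rw [trajectory_succ] at hp'
  set P : ℕ → ℕ := fun i => if hi : i < W.length then p ⟨i, hi⟩ else 0 with hP
  set E : ℕ → ℕ := fun i => if hi : i < W.length then
    p ⟨i, hi⟩ + (W.get ⟨i, hi⟩).length else 0 with hE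
  have hPi : ∀ i (hi : i < W.length), P i = p ⟨i, hi⟩ := fun i hi => by simp only [hP, dif_pos hi]
  have hEi : ∀ i (hi : i < W.length), E i = p ⟨i, hi⟩ + (W.get ⟨i, hi⟩).length :=
    fun i hi => by simp only [hE, dif_pos hi]
  have hsorted : IsSorted (trajectory X T) W.length P E := by
    refine ⟨fun i hi => ?_, fun j hj i hij => ?_, fun x hx => ?_, fun i hi x h1 h2 => ?_,
      fun i hi x y h1 h2 h3 => ?_, fun i hi => ?_, fun i hi => ?_⟩
    · rw [hPi i hi, hEi i hi]
      have := (hp.isBlock ⟨i, hi⟩).length_pos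
      omega
    · rw [hPi j hj, hEi i (hij.trans hj)]
      exact hp.end_le (by simpa using hij)
    · obtain ⟨i, h1, h2⟩ := hp.cover x hx
      refine ⟨i, i.is_lt, ?_⟩
      rw [hPi i i.is_lt, hEi i i.is_lt]
      exact ⟨h1, h2⟩
    · rw [hPi i hi] at h1
      rw [hEi i hi] at h2
      exact (hp.isBlock _).apply_ne_zero h1 h2
    · rw [hPi i hi] at h1
      rw [hEi i hi] at h3
      exact (hp.isBlock _).anti h1 h2 h3
    · rw [hPi i (by omega), hEi i (by omega), hPi _ hi, hEi _ hi]
      have := List.pairwise_iff_getElem.1 hsort i (i + 1) (by simpa using Nat.lt_of_succ_lt hi)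
        (by simpa using hi) (Nat.lt_succ_self i)
      simpa using this
    · rw [hPi i hi, hEi i hi, hp.size_carrier_end hp']
      omega
  rw [← isMaxSum_trajectory_iff T]
  convert hsorted.isMaxSum l using 1
  rw [lastSum_eq_sum]
  push_cast
  refine Finset.sum_congr rfl fun i _ => ?_
  split_ifs with hi
  · have h1 : W.length - 1 - i < W.length := by omega
    rw [hPi _ h1, hEi _ h1, List.getD_eq_getElem _ _ (by simpa using hi)]
    simp
  · rw [List.getD_eq_default _ _ (by simpa using hi)]
    rfl

theorem IsSolitonDecomposition.sum_length (h : IsSolitonDecomposition X T W) (t : ℕ) :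
    (trajectory X t).support.card = (W.map List.length).sum := by
  have hball : ∀ Z : Config κ, Z.support.card = ballsFrom Z (fun _ => True) 0 := fun Z => by
    simp [ballsFrom]
  obtain ⟨p, hp⟩ := (h.2 T le_rfl).exists_isBlocking
  rw [hball, ballsFrom_zero_trajectory, ← ballsFrom_zero_trajectory X _ T, ← hball,
    hp.support_card, ← Fin.sum_univ_fun_getElem W List.length]
  rfl

end

end BoxBall

/-! ### Young diagrams -/

namespace YoungDiagram

theorem sum_rowLen_eq_card (μ : YoungDiagram) (k : ℕ) :
    ∑ i ∈ Finset.range k, μ.rowLen i = (μ.cells.filter fun c => c.1 < k).card := by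
  rw [Finset.card_eq_sum_card_fiberwise (f := Prod.fst) (t := Finset.range k)
    fun c hc => by simpa using (Finset.mem_filter.1 hc).2]
  refine Finset.sum_congr rfl fun i hi => ?_
  rw [rowLen_eq_card, row, Finset.filter_filter]
  congr 1
  refine Finset.filter_congr fun c _ => ⟨fun h => ⟨?_, h⟩, fun h => h.2⟩
  rw [h]; simpa using hi

theorem sum_colLen_eq_card (μ : YoungDiagram) (l : ℕ) :
    ∑ j ∈ Finset.range l, μ.colLen j = (μ.cells.filter fun c => c.2 < l).card := by
  rw [Finset.card_eq_sum_card_fiberwise (f := Prod.snd) (t := Finset.range l)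
    fun c hc => by simpa using (Finset.mem_filter.1 hc).2]
  refine Finset.sum_congr rfl fun i hi => ?_
  rw [colLen_eq_card, col, Finset.filter_filter]
  congr 1
  refine Finset.filter_congr fun c _ => ⟨fun h => ⟨?_, h⟩, fun h => h.2⟩
  rw [h]; simpa using hi

theorem filter_inter_filter (μ : YoungDiagram) (k l : ℕ) :
    (μ.cells.filter fun c => c.1 < k) ∩ (μ.cells.filter fun c => c.2 < l) ⊆
      Finset.range k ×ˢ Finset.range l := by
  intro c hc
  simp only [Finset.mem_inter, Finset.mem_filter] at hc
  simp [hc.1.2, hc.2.2]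

/-- Inclusion-exclusion: the first `k` rows and the first `l` columns overlap inside a `k` by `l`
rectangle. -/
theorem sum_rowLen_add_sum_colLen_le (μ : YoungDiagram) (k l : ℕ) :
    ∑ i ∈ Finset.range k, μ.rowLen i + ∑ j ∈ Finset.range l, μ.colLen j ≤ μ.card + k * l := by
  rw [sum_rowLen_eq_card, sum_colLen_eq_card, ← Finset.card_union_add_card_inter]
  refine Nat.add_le_add (Finset.card_le_card ?_) ?_
  · exact Finset.union_subset (Finset.filter_subset _ _) (Finset.filter_subset _ _)
  · simpa using Finset.card_le_card (μ.filter_inter_filter k l)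

/-- When `l` is the length of the k-th row, whose index is `k - 1`, the overlap is the full
rectangle and every cell below the first `k` rows is in the first `l` columns. -/
theorem sum_rowLen_add_sum_colLen_eq (μ : YoungDiagram) {k : ℕ} (hk : 1 ≤ k) :
    ∑ i ∈ Finset.range k, μ.rowLen i + ∑ j ∈ Finset.range (μ.rowLen (k - 1)), μ.colLen j =
      μ.card + k * μ.rowLen (k - 1) := by
  rw [sum_rowLen_eq_card, sum_colLen_eq_card, ← Finset.card_union_add_card_inter]
  congr 1
  · rw [YoungDiagram.card]
    congr 1
    refine Finset.Subset.antisymm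
      (Finset.union_subset (Finset.filter_subset _ _) (Finset.filter_subset _ _)) ?_
    rintro ⟨i, j⟩ hc
    rw [Finset.mem_union, Finset.mem_filter, Finset.mem_filter]
    rcases Nat.lt_or_ge i k with h | h
    · exact Or.inl ⟨hc, h⟩
    · exact Or.inr ⟨hc, mem_iff_lt_rowLen.1
        (μ.up_left_mem (show k - 1 ≤ i by omega) le_rfl ((mem_cells _).1 hc))⟩
  · have hsub : Finset.range k ×ˢ Finset.range (μ.rowLen (k - 1)) ⊆
        (μ.cells.filter fun c => c.1 < k) ∩ μ.cells.filter fun c => c.2 < μ.rowLen (k - 1) := ?_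
    · rw [(μ.filter_inter_filter k _).antisymm hsub, Finset.card_product, Finset.card_range,
        Finset.card_range]
    rintro ⟨i, j⟩ hc
    simp only [Finset.mem_product, Finset.mem_range] at hc
    have : (i, j) ∈ μ := μ.up_left_mem (show i ≤ k - 1 by omega) le_rfl
      (mem_iff_lt_rowLen.2 hc.2)
    simp [this, hc.1, hc.2]

theorem ext_colLen {μ ν : YoungDiagram} (h : ∀ j, μ.colLen j = ν.colLen j) : μ = ν := by
  ext ⟨i, j⟩
  rw [mem_cells, mem_cells, mem_iff_lt_colLen, mem_iff_lt_colLen, h]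

theorem exists_colLen_eq {w : List ℕ} (hw : w.SortedGE) :
    ∃ μ : YoungDiagram, ∀ j, μ.colLen j = w.getD j 0 := by
  refine ⟨(ofRowLens w hw).transpose, fun j => ?_⟩
  rw [colLen_transpose]
  rcases Nat.lt_or_ge j w.length with h | h
  · rw [List.getD_eq_getElem _ _ h]
    exact rowLen_ofRowLens ⟨j, h⟩
  · rw [List.getD_eq_default _ _ h]
    by_contra hc
    have := mem_iff_lt_rowLen.2 (Nat.pos_of_ne_zero hc)
    rw [mem_ofRowLens] at this
    exact this.1.not_ge h

theorem card_eq_sum {μ : YoungDiagram} {w : List ℕ} (h : ∀ j, μ.colLen j = w.getD j 0) :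
    μ.card = w.sum := by
  have h1 : μ.cells = μ.cells.filter fun c => c.2 < w.length := by
    refine (Finset.filter_true_of_mem ?_).symm
    rintro ⟨i, j⟩ hc
    by_contra hj
    have := mem_iff_lt_colLen.1 ((mem_cells _).1 hc)
    rw [h, List.getD_eq_default _ _ (not_lt.1 hj)] at this
    exact absurd this (Nat.not_lt_zero i)
  rw [YoungDiagram.card, h1, ← sum_colLen_eq_card, Finset.sum_range, ← Fin.sum_univ_getElem]
  exact Finset.sum_congr rfl fun j _ => by rw [h, List.getD_eq_getElem _ _ j.is_lt]

end YoungDiagram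

/-! ### Rows and columns of the soliton diagram -/

namespace BoxBall

variable {κ : ℕ} {X : Config κ} {Λ : YoungDiagram}

theorem IsSolitonDiagram.isMaxSum (h : IsSolitonDiagram X Λ) (l t : ℕ) :
    IsMaxSum (trajectory X t) l (∑ j ∈ Finset.range l, (Λ.colLen j : ℤ)) := by
  obtain ⟨T, W, hW, hΛ⟩ := h
  rw [isMaxSum_trajectory_iff]
  simpa only [hΛ] using hW.isMaxSum l

theorem IsSolitonDiagram.card_eq (h : IsSolitonDiagram X Λ) (t : ℕ) :
    (trajectory X t).support.card = Λ.card := by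
  obtain ⟨T, W, hW, hΛ⟩ := h
  rw [hW.sum_length, YoungDiagram.card_eq_sum hΛ, List.sum_reverse]

/-- The partial column sums are maxima that depend on `X` only, and their differences are the
columns. -/
theorem IsSolitonDiagram.unique {Λ' : YoungDiagram} (h : IsSolitonDiagram X Λ)
    (h' : IsSolitonDiagram X Λ') : Λ = Λ' := by
  have key : ∀ l, ∑ j ∈ Finset.range l, (Λ.colLen j : ℤ) =
      ∑ j ∈ Finset.range l, (Λ'.colLen j : ℤ) := fun l =>
    (h.isMaxSum l 0).isGreatest.unique (h'.isMaxSum l 0).isGreatest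
  refine YoungDiagram.ext_colLen fun j => ?_
  have h1 := key (j + 1)
  rw [Finset.sum_range_succ, Finset.sum_range_succ, key j] at h1
  omega

theorem exists_isSolitonDiagram (X : Config κ) : ∃ Λ, IsSolitonDiagram X Λ := by
  obtain ⟨T, W, hW⟩ := exists_isSolitonDecomposition X
  obtain ⟨Λ, hΛ⟩ := YoungDiagram.exists_colLen_eq (w := (W.map List.length).reverse)
    (List.pairwise_reverse.2 hW.1).sortedGE
  exact ⟨Λ, T, W, hW, hΛ⟩

theorem IsSolitonDiagram.isGreatest_sum_NA (h : IsSolitonDiagram X Λ) {k : ℕ} (hk : 1 ≤ k)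
    (t : ℕ) : IsGreatest {n : ℕ | ∃ A : Fin k → Set ℕ, (∀ i j, i ≠ j → Disjoint (A i) (A j)) ∧
      (⋃ i, A i) = Set.univ ∧ n = ∑ i, NA (A i) (trajectory X t)}
      (∑ j ∈ Finset.range k, Λ.rowLen j) := by
  have hN := h.card_eq t
  have hle : ∀ A : Fin k → Set ℕ, (∀ i j, i ≠ j → Disjoint (A i) (A j)) →
      (⋃ i, A i) = Set.univ →
      ∑ i, NA (A i) (trajectory X t) ≤ ∑ j ∈ Finset.range k, Λ.rowLen j := by
    intro A hA hAu
    -- With this number of sets the inequality for the diagram is an equality, so weak duality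
    -- yields the sharp bound.
    obtain ⟨e, he⟩ := (h.isMaxSum (Λ.rowLen (k - 1)) t).1
    have h1 := sum_NA_add_le hA hAu he
    have h2 := Λ.sum_rowLen_add_sum_colLen_eq hk
    rw [hN] at h1
    zify at h2 ⊢
    push_cast at h1
    linarith
  refine ⟨?_, ?_⟩
  · have : NeZero k := ⟨by omega⟩
    -- Here `l` is whatever the greedy partition produces; the inequality for the diagram holds for
    -- every `l`.
    obtain ⟨A, hA, hAu, l, e, n, hn, hle'⟩ := exists_partition (k := k) (trajectory X t)
    refine ⟨A, hA, hAu, le_antisymm ?_ (hle A hA hAu)⟩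
    have h1 := (h.isMaxSum l t).2 e n hn
    have h2 := Λ.sum_rowLen_add_sum_colLen_le k l
    rw [hN] at hle'
    zify at h2 ⊢
    push_cast at hle'
    linarith
  · rintro n ⟨A, hA, hAu, rfl⟩
    exact hle A hA hAu

end BoxBall

theorem lemma2p1 (κ : ℕ) (X₀ : BoxBall.Config κ) :
    (∃! Λ : YoungDiagram, BoxBall.IsSolitonDiagram X₀ Λ) ∧
    ∀ Λ : YoungDiagram, BoxBall.IsSolitonDiagram X₀ Λ → ∀ k t : ℕ,
      (1 ≤ k →
        IsGreatest
          {n : ℕ | ∃ A : Fin k → Set ℕ, (∀ i j, i ≠ j → Disjoint (A i) (A j)) ∧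
            (⋃ i, A i) = Set.univ ∧
            n = ∑ i, BoxBall.NA (A i) (BoxBall.trajectory X₀ t)}
          (∑ j ∈ Finset.range k, Λ.rowLen j)) ∧
      IsGreatest
        {n : ℤ | ∃ A : Fin k → Finset ℕ, (∀ i j, i < j → BoxBall.Precedes (A i) (A j)) ∧
          n = ∑ i, BoxBall.penalizedLength (A i) (BoxBall.trajectory X₀ t)}
        (∑ j ∈ Finset.range k, (Λ.colLen j : ℤ)) := by
  refine ⟨?_, fun Λ hΛ k t => ⟨fun hk => hΛ.isGreatest_sum_NA hk t, (hΛ.isMaxSum k t).isGreatest⟩⟩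
  obtain ⟨Λ, hΛ⟩ := BoxBall.exists_isSolitonDiagram X₀
  exact ⟨Λ, hΛ, fun Λ' hΛ' => hΛ'.unique hΛ⟩
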